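/- Let $G$ be a locally compact étale groupoid (not necessarily Hausdorff) whose unit space $G^0$ is Hausdorff; étale means that the topology has a basis of open bisections, i.e. of open sets on which the source and range maps $s,r$ are homeomorphisms onto open subsets of $G^0$. Let $\mathrm{Bis}(G)$ be the inverse semigroup of all open bisections, with unit $G^0$, product $uv=\{gh: g\in u,\ h\in v,\ s(g)=r(h)\}$ and $u^*=\{g^{-1}:g\in u\}$. It acts on $G^0$ canonically: $u\in\mathrm{Bis}(G)$ acts as the homeomorphism $s(u)\to r(u)$, $s(g)\mapsto r(g)$ for $g\in u$. An inverse subsemigroup $S\subseteq\mathrm{Bis}(G)$ is *wide* if $\bigcup_{u\in S}u=G$ and for all $u,v\in S$ and $g\in u\cap v$ there is $w\in S$ with $g\in w\subseteq u\cap v$. $G$ is *topologically amenable* if there is a net $(\eta_i)$ in $C_c(G)$ (the span of the functions on $G$ that are continuous on some open bisection and vanish off a compact subset of it) with $\sup_{x\in G^0}\bigl(\sum_{r(h)=x}|\eta_i(h)|^2\bigr)^{1/2}\le 1$ for all $i$ and $\sum_{r(h)=r(g)}\overline{\eta_i(h)}\,\eta_i(g^{-1}h)\to 1$ uniformly for $g$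 in compact subsets of $G$. Let $S$ be a unital inverse semigroup. A Fell bundle $\mathcal A=(A_s)_{s\in S}$ over $S$ has the *approximation property* if there is a net of finitely supported functions $\xi_i\colon S\to A_1$ with $\xi_i(p)\in A_{pp^*}$ for all $p\in S$ such that $$\sup_i\Bigl\|\sum_{p,t\in S}\xi_i(p)^*\xi_i(t)1_{pt^*}\Bigr\|<\infty\quad\text{and}\quad \sum_{p,t\in S}1_{p(st)^*}\xi_i(p)^*a\,\xi_i(t)\to a\ \text{ in norm, for all } s\in S,\ a\in A_s,$$ where $1_s\in A_1''$ is the unit of the bidual $I_{s,1}''$ of the closed ideal $I_{s,1}\subseteq A_1$ generated by the $A_{v^*v}$ with $v\le s$ and $v\le 1$, and the sums are taken in the biduals $A_1''$ and $A_s''$. An action $\alpha$ of $S$ on a locally compact Hausdorff space $X$ by homeomorphisms between open subsets has the approximation property if its Fell bundle has it; this has the fibres $A_s=C_0(\operatorname{ran}\alpha_s)\subseteq C_0(X)$ with $(f\delta_s)(g\delta_t)=f\cdot(g\circ\alpha_s^{-1})\,\delta_{st}$ and $(f\delta_s)^*=(\overline f\circ\alpha_s)\,\delta_{s^*}$. (If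 a wide $S\subseteq\mathrm{Bis}(G)$ has no unit, the unit $G^0$ is adjoined to it.) Then the following assertions are equivalent: (i) $G$ is topologically amenable; (ii) the canonical action of $\mathrm{Bis}(G)$ on $G^0$ has the approximation property; (iii) for every wide inverse subsemigroup $S\subseteq\mathrm{Bis}(G)$, the canonical action of $S$ on $G^0$ has the approximation property. Moreover, for each single wide inverse subsemigroup $S\subseteq\mathrm{Bis}(G)$, the canonical action of $S$ on $G^0$ has the approximation property if and only if $G$ is topologically amenable. -/

import Mathlib

noncomputable section

open Filter Topology
open scoped ZeroAtInfty ComplexConjugate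

namespace InvFell

universe u

/-! ### Inverse semigroups with unit -/

/-- An inverse semigroup with unit: every `s` has exactly one generalized inverse, written `s⁻¹`. -/
class InverseMonoid (S : Type u) extends Monoid S, Inv S where
  mul_inv_mul_self : ∀ s : S, s * s⁻¹ * s = s
  inv_mul_inv_self : ∀ s : S, s⁻¹ * s * s⁻¹ = s⁻¹
  inv_unique : ∀ s t : S, s * t * s = s → t * s * t = t → t = s⁻¹

namespace InverseMonoid

variable {S : Type u} [InverseMonoid S]

/-- The natural partial order: `s ≤ t` iff `s = t * e` for some idempotent `e`. -/
def NatLE (s t : S) : Prop := ∃ e : S, e * e = e ∧ s = t * e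

theorem inv_inv_eq (s : S) : s⁻¹⁻¹ = s :=
  (inv_unique s⁻¹ s (inv_mul_inv_self s) (mul_inv_mul_self s)).symm

theorem inv_idem {e : S} (he : e * e = e) : e⁻¹ = e :=
  (inv_unique e e (by rw [he, he]) (by rw [he, he])).symm

theorem idem_mul_idem {e f : S} (he : e * e = e) (hf : f * f = f) :
    (e * f) * (e * f) = e * f := by
  set x := (e * f)⁻¹ with hx
  have h1 : e * f * x * (e * f) = e * f := mul_inv_mul_self _
  have h2 : x * (e * f) * x = x := inv_mul_inv_self _
  have h3 : f * x * e = x := by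
    refine inv_unique _ _ ?_ ?_
    · calc e * f * (f * x * e) * (e * f) = e * (f * f) * x * (e * e) * f := by
            simp only [mul_assoc]
        _ = e * f * x * (e * f) := by rw [he, hf]; simp only [mul_assoc]
        _ = e * f := h1
    · calc f * x * e * (e * f) * (f * x * e) = f * x * (e * e) * (f * f) * x * e := by
            simp only [mul_assoc]
        _ = f * (x * (e * f) * x) * e := by rw [he, hf]; simp only [mul_assoc]
        _ = f * x * e := by rw [h2]
  have h4 : x * x = x := by
    calc x * x = (f * x * e) * (f * x * e) := by rw [h3]
      _ = f * (x * (e * f) * x) * e := by simp only [mul_assoc]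
      _ = x := by rw [h2, h3]
  have h5 : e * f = x := by
    rw [← inv_inv_eq (e * f), ← hx, inv_idem h4]
  rw [h5, h4]

theorem idem_comm {e f : S} (he : e * e = e) (hf : f * f = f) : e * f = f * e := by
  have h1 := idem_mul_idem he hf
  have h2 := idem_mul_idem hf he
  have h3 : f * e = (e * f)⁻¹ := by
    refine inv_unique _ _ ?_ ?_
    · calc e * f * (f * e) * (e * f) = e * (f * f) * (e * e) * f := by simp only [mul_assoc]
        _ = (e * f) * (e * f) := by rw [he, hf]; simp only [mul_assoc]
        _ = e * f := h1
    · calc f * e * (e * f) * (f * e) = f * (e * e) * (f * f) * e := by simp only [mul_assoc]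
        _ = (f * e) * (f * e) := by rw [he, hf]; simp only [mul_assoc]
        _ = f * e := h2
  rw [h3, inv_idem h1]

theorem idem_inv_mul (s : S) : (s⁻¹ * s) * (s⁻¹ * s) = s⁻¹ * s := by
  rw [← mul_assoc, inv_mul_inv_self]

theorem idem_mul_inv (s : S) : (s * s⁻¹) * (s * s⁻¹) = s * s⁻¹ := by
  rw [← mul_assoc, mul_inv_mul_self]

theorem idem_conj {e : S} (he : e * e = e) (t : S) :
    (t⁻¹ * e * t) * (t⁻¹ * e * t) = t⁻¹ * e * t := by
  calc (t⁻¹ * e * t) * (t⁻¹ * e * t) = t⁻¹ * (e * (t * t⁻¹)) * e * t := by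
        simp only [mul_assoc]
    _ = t⁻¹ * ((t * t⁻¹) * e) * e * t := by rw [idem_comm he (idem_mul_inv t)]
    _ = (t⁻¹ * t * t⁻¹) * (e * e) * t := by simp only [mul_assoc]
    _ = t⁻¹ * e * t := by rw [inv_mul_inv_self, he]

theorem idem_mul_eq {e : S} (he : e * e = e) (t : S) : e * t = t * (t⁻¹ * e * t) := by
  calc e * t = e * (t * t⁻¹ * t) := by rw [mul_inv_mul_self]
    _ = (e * (t * t⁻¹)) * t := by simp only [mul_assoc]
    _ = ((t * t⁻¹) * e) * t := by rw [idem_comm he (idem_mul_inv t)]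
    _ = t * (t⁻¹ * e * t) := by simp only [mul_assoc]

theorem mul_inv_eq (s t : S) : (s * t)⁻¹ = t⁻¹ * s⁻¹ := by
  have hc := idem_comm (idem_mul_inv t) (idem_inv_mul s)
  refine (inv_unique _ _ ?_ ?_).symm
  · calc s * t * (t⁻¹ * s⁻¹) * (s * t) = s * ((t * t⁻¹) * (s⁻¹ * s)) * t := by
          simp only [mul_assoc]
      _ = (s * s⁻¹ * s) * (t * t⁻¹ * t) := by rw [hc]; simp only [mul_assoc]
      _ = s * t := by rw [mul_inv_mul_self, mul_inv_mul_self]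
  · calc t⁻¹ * s⁻¹ * (s * t) * (t⁻¹ * s⁻¹) = t⁻¹ * ((s⁻¹ * s) * (t * t⁻¹)) * s⁻¹ := by
          simp only [mul_assoc]
      _ = (t⁻¹ * t * t⁻¹) * (s⁻¹ * s * s⁻¹) := by rw [← hc]; simp only [mul_assoc]
      _ = t⁻¹ * s⁻¹ := by rw [inv_mul_inv_self, inv_mul_inv_self]

theorem natLE_of_eq {s t : S} (h : s = t) : NatLE s t := ⟨1, by simp, by simp [h]⟩

theorem natLE_trans {r s t : S} (h : NatLE r s) (h' : NatLE s t) : NatLE r t := by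
  obtain ⟨e, he, rfl⟩ := h
  obtain ⟨f, hf, rfl⟩ := h'
  exact ⟨f * e, idem_mul_idem hf he, mul_assoc _ _ _⟩

theorem natLE_mul {s s' t t' : S} (h : NatLE s s') (h' : NatLE t t') :
    NatLE (s * t) (s' * t') := by
  obtain ⟨e, he, rfl⟩ := h
  obtain ⟨f, hf, rfl⟩ := h'
  refine ⟨(t'⁻¹ * e * t') * f, idem_mul_idem (idem_conj he _) hf, ?_⟩
  calc s' * e * (t' * f) = s' * (e * t') * f := by simp only [mul_assoc]
    _ = s' * (t' * (t'⁻¹ * e * t')) * f := by rw [← idem_mul_eq he]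
    _ = s' * t' * (t'⁻¹ * e * t' * f) := by simp only [mul_assoc]

theorem natLE_inv {s t : S} (h : NatLE s t) : NatLE s⁻¹ t⁻¹ := by
  obtain ⟨e, he, rfl⟩ := h
  exact ⟨t⁻¹⁻¹ * e * t⁻¹, idem_conj he _, by rw [mul_inv_eq, inv_idem he, idem_mul_eq he]⟩

theorem idem_natLE_one {e : S} (he : e * e = e) : NatLE e 1 := ⟨e, he, (one_mul e).symm⟩

end InverseMonoid

open InverseMonoid

/-- A unital inverse subsemigroup (same unit) of an inverse semigroup with unit. -/
structure InverseSubmonoid (M : Type u) [InverseMonoid M] extends Submonoid M where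
  inv_mem : ∀ s ∈ carrier, s⁻¹ ∈ carrier

/-- The elements of an inverse subsemigroup, as a type. -/
def InverseSubmonoid.Elem {M : Type u} [InverseMonoid M] (S : InverseSubmonoid M) : Type u :=
  S.toSubmonoid

instance {M : Type u} [InverseMonoid M] (S : InverseSubmonoid M) : InverseMonoid S.Elem where
  toMonoid := inferInstanceAs (Monoid S.toSubmonoid)
  inv s := ⟨s.1⁻¹, S.inv_mem _ s.2⟩
  mul_inv_mul_self s := Subtype.ext (mul_inv_mul_self s.1)
  inv_mul_inv_self s := Subtype.ext (inv_mul_inv_self s.1)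
  inv_unique s t h h' := Subtype.ext
    (inv_unique s.1 t.1 (congrArg Subtype.val h) (congrArg Subtype.val h'))

/-- An inverse subsemigroup of an inverse semigroup, with or without the unit. -/
structure InverseSubsemigroup (M : Type u) [InverseMonoid M] extends Subsemigroup M where
  inv_mem : ∀ s ∈ carrier, s⁻¹ ∈ carrier

/-- `S ∪ {1}`; this is `S` itself if `S` contains the unit. -/
def InverseSubsemigroup.unitize {M : Type u} [InverseMonoid M] (S : InverseSubsemigroup M) :
    InverseSubmonoid M where
  carrier := {s | s = 1 ∨ s ∈ S.carrier}
  one_mem' := Or.inl rfl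
  mul_mem' := by
    rintro s t (rfl | hs) (rfl | ht)
    · exact Or.inl (one_mul 1)
    · exact Or.inr (by rwa [one_mul])
    · exact Or.inr (by rwa [mul_one])
    · exact Or.inr (S.mul_mem' hs ht)
  inv_mem := by
    rintro s (rfl | hs)
    · exact Or.inl (inv_idem (mul_one 1))
    · exact Or.inr (S.inv_mem s hs)

/-! ### Fell bundles over inverse semigroups -/

/-- A (not necessarily saturated) Fell bundle over a unital inverse semigroup `S`: Banach spaces
`A_s`, multiplications `A_s × A_t → A_{st}`, involutions `A_s → A_{s*}` and inclusions
`A_s ⊆ A_t` for `s ≤ t`. Since `s = t` implies `s ≤ t`, the inclusions also serve to identify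
fibres over equal elements. Positivity of `a* a` in the `C*`-algebra `A_{s* s}` is expressed as
`a* a = c* c` with `c ∈ A_{s* s}`. -/
structure FellBundle (S : Type u) [InverseMonoid S] where
  Fib : S → Type u
  [normed : ∀ s, NormedAddCommGroup (Fib s)]
  [space : ∀ s, NormedSpace ℂ (Fib s)]
  [complete : ∀ s, CompleteSpace (Fib s)]
  mul : ∀ {s t : S}, Fib s →ₗ[ℂ] Fib t →ₗ[ℂ] Fib (s * t)
  star : ∀ {s : S}, Fib s →ₗ⋆[ℂ] Fib s⁻¹
  incl : ∀ {s t : S}, NatLE s t → Fib s →ₗᵢ[ℂ] Fib t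
  norm_mul_le : ∀ {s t : S} (a : Fib s) (b : Fib t), ‖mul a b‖ ≤ ‖a‖ * ‖b‖
  mul_assoc : ∀ {s t r : S} (a : Fib s) (b : Fib t) (c : Fib r),
    incl (natLE_of_eq (_root_.mul_assoc s t r)) (mul (mul a b) c) = mul a (mul b c)
  norm_star : ∀ {s : S} (a : Fib s), ‖star a‖ = ‖a‖
  star_star : ∀ {s : S} (a : Fib s), incl (natLE_of_eq (inv_inv_eq s)) (star (star a)) = a
  star_mul : ∀ {s t : S} (a : Fib s) (b : Fib t),
    incl (natLE_of_eq (mul_inv_eq s t)) (star (mul a b)) = mul (star b) (star a)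
  norm_star_mul_self : ∀ {s : S} (a : Fib s), ‖mul (star a) a‖ = ‖a‖ ^ 2
  star_mul_self_pos : ∀ {s : S} (a : Fib s), ∃ c : Fib (s⁻¹ * s),
    mul (star a) a = incl (natLE_of_eq (by rw [inv_idem (idem_inv_mul s), idem_inv_mul s]))
      (mul (star c) c)
  incl_refl : ∀ {s : S} (a : Fib s), incl (natLE_of_eq rfl) a = a
  incl_trans : ∀ {r s t : S} (h : NatLE r s) (h' : NatLE s t) (a : Fib r),
    incl h' (incl h a) = incl (natLE_trans h h') a
  incl_mul : ∀ {s s' t t' : S} (h : NatLE s s') (h' : NatLE t t') (a : Fib s) (b : Fib t),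
    mul (incl h a) (incl h' b) = incl (natLE_mul h h') (mul a b)
  incl_star : ∀ {s t : S} (h : NatLE s t) (a : Fib s),
    star (incl h a) = incl (natLE_inv h) (star a)

attribute [instance] FellBundle.normed FellBundle.space FellBundle.complete

/-! ### Biduals -/

/-- The bidual `E''` of a Banach space `E`; for a `C*`-algebra, with the product `arens`, it is the
enveloping von Neumann algebra. -/
abbrev Bidual (E : Type u) [NormedAddCommGroup E] [NormedSpace ℂ E] : Type u :=
  StrongDual ℂ (StrongDual ℂ E)

/-- The canonical embedding `E ⊆ E''`. -/
abbrev toBidual {E : Type u} [NormedAddCommGroup E] [NormedSpace ℂ E] (a : E) : Bidual E :=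
  NormedSpace.inclusionInDoubleDual ℂ E a

/-- The canonical extension `E'' × F'' → H''` of a bounded bilinear map `m : E × F → H`, given by
`(x ⬝ y)(φ) = x (a ↦ y (b ↦ φ (m a b)))`. -/
def arens {E F H : Type u} [NormedAddCommGroup E] [NormedSpace ℂ E] [NormedAddCommGroup F]
    [NormedSpace ℂ F] [NormedAddCommGroup H] [NormedSpace ℂ H]
    (m : E →L[ℂ] F →L[ℂ] H) (x : Bidual E) (y : Bidual F) : Bidual H :=
  x ∘L (ContinuousLinearMap.compL ℂ E (StrongDual ℂ F) ℂ y) ∘L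
    ((ContinuousLinearMap.compL ℂ E (F →L[ℂ] H) (StrongDual ℂ F)).flip m) ∘L
      (ContinuousLinearMap.compL ℂ F H ℂ)

theorem arens_apply {E F H : Type u} [NormedAddCommGroup E] [NormedSpace ℂ E]
    [NormedAddCommGroup F] [NormedSpace ℂ F] [NormedAddCommGroup H] [NormedSpace ℂ H]
    (m : E →L[ℂ] F →L[ℂ] H) (x : Bidual E) (y : Bidual F) (φ : StrongDual ℂ H) :
    arens m x y φ = x (y ∘L (ContinuousLinearMap.compL ℂ F H ℂ φ) ∘L m) := rfl

namespace FellBundle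

variable {S : Type u} [InverseMonoid S] (A : FellBundle S)

/-- The multiplication of a Fell bundle as a bounded bilinear map. -/
def mulL (s t : S) : A.Fib s →L[ℂ] A.Fib t →L[ℂ] A.Fib (s * t) :=
  A.mul.mkContinuous₂ 1 fun a b => by simpa using A.norm_mul_le a b

/-- The left multiplication `A_1 × A_s → A_s`; for `s = 1` it is the product of `A_1`. -/
def lmul (s : S) : A.Fib 1 →L[ℂ] A.Fib s →L[ℂ] A.Fib s :=
  ContinuousLinearMap.compL ℂ (A.Fib s) (A.Fib (1 * s)) (A.Fib s)
    (A.incl (natLE_of_eq (one_mul s))).toContinuousLinearMap ∘L A.mulL 1 s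

/-- The right multiplication `A_s × A_1 → A_s`. -/
def rmul (s : S) : A.Fib s →L[ℂ] A.Fib 1 →L[ℂ] A.Fib s :=
  ContinuousLinearMap.compL ℂ (A.Fib 1) (A.Fib (s * 1)) (A.Fib s)
    (A.incl (natLE_of_eq (mul_one s))).toContinuousLinearMap ∘L A.mulL s 1

/-- The involution of the `C*`-algebra `A_1`. -/
def starOne (a : A.Fib 1) : A.Fib 1 :=
  A.incl (natLE_of_eq (inv_idem (mul_one 1))) (A.star a)

/-- The ideal `A_e`, for an idempotent `e`, as a subspace of `A_1`. -/
def idemIdeal (e : S) (he : e * e = e) : Submodule ℂ (A.Fib 1) :=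
  LinearMap.range (A.incl (idem_natLE_one he)).toLinearMap

/-- `I_{s,t}`: the closed two-sided ideal of `A_1` generated by the `A_{v* v}` with `v ≤ s, t`. -/
def idealOf (s t : S) : Submodule ℂ (A.Fib 1) :=
  sInf {J | IsClosed (J : Set (A.Fib 1)) ∧
    (∀ a : A.Fib 1, ∀ b ∈ J, A.lmul 1 a b ∈ J ∧ A.lmul 1 b a ∈ J) ∧
    ∀ v : S, NatLE v s → NatLE v t → A.idemIdeal (v⁻¹ * v) (idem_inv_mul v) ≤ J}

/-- `J'' ⊆ A_1''`, the bidual (bipolar, i.e. weak-star closure) of a subspace `J` of `A_1`. -/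
def bidualOf (J : Submodule ℂ (A.Fib 1)) : Set (Bidual (A.Fib 1)) :=
  {x | ∀ φ : StrongDual ℂ (A.Fib 1), (∀ b ∈ J, φ b = 0) → x φ = 0}

/-- `e` is the unit of `J''`. -/
def IsUnitOf (J : Submodule ℂ (A.Fib 1)) (e : Bidual (A.Fib 1)) : Prop :=
  e ∈ A.bidualOf J ∧
    ∀ x ∈ A.bidualOf J, arens (A.lmul 1) e x = x ∧ arens (A.lmul 1) x e = x

theorem IsUnitOf.unique {J : Submodule ℂ (A.Fib 1)} {e f : Bidual (A.Fib 1)}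
    (he : A.IsUnitOf J e) (hf : A.IsUnitOf J f) : e = f :=
  (hf.2 e he.1).2.symm.trans (he.2 f hf.1).1

open Classical in
/-- `1_s`, the unit of the von Neumann algebra `I_{s,1}''` (it exists, since `I_{s,1}` is a closed
ideal of a `C*`-algebra, and it is unique). -/
def unitProj (s : S) : Bidual (A.Fib 1) :=
  if h : ∃ e, A.IsUnitOf (A.idealOf s 1) e then h.choose else 0

/-- `Γ_c(S, A)`: finitely supported `ξ : S → A_1` with `ξ(p) ∈ A_{p p*}`. -/
def sections : Set (S →₀ A.Fib 1) :=
  {ξ | ∀ p, ξ p ∈ A.idemIdeal (p * p⁻¹) (idem_mul_inv p)}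

/-- The approximation property of a Fell bundle over a unital inverse semigroup. -/
def ApproximationProperty : Prop :=
  ∃ (I : Type u) (_ : Preorder I) (_ : IsDirectedOrder I) (_ : Nonempty I)
    (ξ : I → S →₀ A.Fib 1),
    (∀ i, ξ i ∈ A.sections) ∧
    (∃ C : ℝ, ∀ i, ‖∑ p ∈ (ξ i).support, ∑ t ∈ (ξ i).support,
      arens (A.lmul 1) (toBidual (A.lmul 1 (A.starOne (ξ i p)) (ξ i t)))
        (A.unitProj (p * t⁻¹))‖ ≤ C) ∧
    ∀ (s : S) (a : A.Fib s), Tendsto (fun i => ∑ p ∈ (ξ i).support, ∑ t ∈ (ξ i).support,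
      arens (A.lmul s) (A.unitProj (p * (s * t)⁻¹))
        (toBidual (A.rmul s (A.lmul s (A.starOne (ξ i p)) a) (ξ i t))))
      atTop (𝓝 (toBidual a))

end FellBundle

/-! ### Actions on spaces and their Fell bundles -/

/-- An action of a unital inverse semigroup on a space by homeomorphisms between open subsets
(`≈` is equality of partial homeomorphisms: same source, same values there). -/
structure PartialAction (S : Type u) [InverseMonoid S] (X : Type u) [TopologicalSpace X] where
  act : S → OpenPartialHomeomorph X X
  act_one : act 1 ≈ OpenPartialHomeomorph.refl X
  act_mul : ∀ s t, act (s * t) ≈ (act t).trans (act s)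
  act_inv : ∀ s, act s⁻¹ ≈ (act s).symm

/-- Restriction of an action to an inverse subsemigroup. -/
def PartialAction.restrict {M : Type u} [InverseMonoid M] {X : Type u} [TopologicalSpace X]
    (α : PartialAction M X) (S : InverseSubmonoid M) : PartialAction S.Elem X where
  act s := α.act s.1
  act_one := α.act_one
  act_mul s t := α.act_mul s.1 t.1
  act_inv s := α.act_inv s.1

namespace PartialAction

variable {S : Type u} [InverseMonoid S] {X : Type u} [TopologicalSpace X] (α : PartialAction S X)

theorem source_inv (s : S) : (α.act s⁻¹).source = (α.act s).target := (α.act_inv s).source_eq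

theorem target_inv (s : S) : (α.act s⁻¹).target = (α.act s).source := (α.act_inv s).target_eq

theorem act_inv_apply (s : S) {x : X} (hx : x ∈ (α.act s).target) :
    α.act s⁻¹ x = (α.act s).symm x :=
  (α.act_inv s).eqOn (by rwa [source_inv])

theorem act_inv_symm_apply (s : S) {x : X} (hx : x ∈ (α.act s).source) :
    (α.act s⁻¹).symm x = α.act s x := by
  have := (α.act_inv s).symm_eqOn_target (x := x) (by rwa [target_inv])
  simpa using this

theorem mem_source_mul (s t : S) (x : X) : x ∈ (α.act (s * t)).source ↔
    x ∈ (α.act t).source ∧ α.act t x ∈ (α.act s).source := by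
  rw [(α.act_mul s t).source_eq, OpenPartialHomeomorph.trans_source]; rfl

theorem act_mul_apply (s t : S) {x : X} (hx : x ∈ (α.act (s * t)).source) :
    α.act (s * t) x = α.act s (α.act t x) := (α.act_mul s t).eqOn hx

theorem mem_target_mul (s t : S) (x : X) : x ∈ (α.act (s * t)).target ↔
    x ∈ (α.act s).target ∧ (α.act s).symm x ∈ (α.act t).target := by
  rw [(α.act_mul s t).target_eq, OpenPartialHomeomorph.trans_target]; rfl

theorem act_mul_symm_apply (s t : S) {x : X} (hx : x ∈ (α.act (s * t)).target) :
    (α.act (s * t)).symm x = (α.act t).symm ((α.act s).symm x) :=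
  (α.act_mul s t).symm_eqOn_target hx

theorem act_idem {e : S} (he : e * e = e) {x : X} (hx : x ∈ (α.act e).source) :
    α.act e x = x := by
  have hx' : x ∈ (α.act (e * e)).source := by rwa [he]
  have h1 := (α.mem_source_mul e e x).1 hx'
  have h2 := α.act_mul_apply e e hx'
  rw [he] at h2
  exact (α.act e).injOn h1.2 hx h2.symm

theorem natLE_source {s t : S} (h : NatLE s t) {x : X} (hx : x ∈ (α.act s).source) :
    x ∈ (α.act t).source ∧ α.act t x = α.act s x := by
  obtain ⟨e, he, rfl⟩ := h
  have h1 := (α.mem_source_mul t e x).1 hx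
  have h2 := α.act_mul_apply t e hx
  rw [α.act_idem he h1.1] at h1 h2
  exact ⟨h1.2, h2.symm⟩

theorem natLE_target {s t : S} (h : NatLE s t) {x : X} (hx : x ∈ (α.act s).target) :
    x ∈ (α.act t).target ∧ (α.act t).symm x = (α.act s).symm x := by
  have h1 := (α.act s).map_target hx
  obtain ⟨h2, h3⟩ := α.natLE_source h h1
  rw [(α.act s).right_inv hx] at h3
  constructor
  · rw [← h3]; exact (α.act t).map_source h2
  · conv_lhs => rw [← h3]
    exact (α.act t).left_inv h2

end PartialAction

section C0

variable {X : Type u} [TopologicalSpace X]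

theorem c0_norm_le (f : C₀(X, ℂ)) (x : X) : ‖f x‖ ≤ ‖f‖ := by
  rw [← ZeroAtInftyContinuousMap.norm_toBCF_eq_norm]
  exact f.toBCF.norm_coe_le_norm x

theorem c0_norm_le_of (f : C₀(X, ℂ)) {C : ℝ} (hC : 0 ≤ C) (h : ∀ x, ‖f x‖ ≤ C) : ‖f‖ ≤ C := by
  rw [← ZeroAtInftyContinuousMap.norm_toBCF_eq_norm]
  exact (BoundedContinuousFunction.norm_le hC).2 h

theorem c0_compact (f : C₀(X, ℂ)) {ε : ℝ} (hε : 0 < ε) : IsCompact {x | ε ≤ ‖f x‖} := by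
  have h1 : Tendsto (fun x => ‖f x‖) (cocompact X) (𝓝 0) := by
    simpa using (zero_at_infty f).norm
  have h2 : ∀ᶠ x in cocompact X, ‖f x‖ < ε := h1.eventually (gt_mem_nhds hε)
  obtain ⟨K, hK, hKs⟩ := mem_cocompact.1 h2
  refine hK.of_isClosed_subset (isClosed_le continuous_const (map_continuous f).norm) ?_
  intro x hx
  by_contra hxK
  have h3 : ‖f x‖ < ε := hKs hxK
  exact absurd hx (not_le.2 h3)

/-- The function `|f|`. -/
def absC0 (f : C₀(X, ℂ)) : C₀(X, ℂ) where
  toFun x := (‖f x‖ : ℂ)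
  continuous_toFun := Complex.continuous_ofReal.comp (map_continuous f).norm
  zero_at_infty' := by
    have h1 : Tendsto (fun x => ‖f x‖) (cocompact X) (𝓝 0) := by
      simpa using (zero_at_infty f).norm
    have h2 := (Complex.continuous_ofReal.tendsto 0).comp h1
    rw [Complex.ofReal_zero] at h2
    exact h2

/-- `f · (g ∘ e⁻¹)`, extended by zero, for `f` vanishing off the target of `e`. -/
def twistMul (e : OpenPartialHomeomorph X X) (f g : C₀(X, ℂ)) (hf : ∀ x ∉ e.target, f x = 0) :
    C₀(X, ℂ) where
  toFun x := f x * g (e.symm x)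
  continuous_toFun := by
    rw [continuous_iff_continuousAt]
    intro x
    by_cases hx : x ∈ e.target
    · exact (map_continuous f).continuousAt.mul
        ((map_continuous g).continuousAt.comp (e.continuousAt_symm hx))
    · change Tendsto _ _ (𝓝 (f x * g (e.symm x)))
      rw [hf x hx, zero_mul]
      refine squeeze_zero_norm (a := fun y => ‖f y‖ * ‖g‖) (fun y => ?_) ?_
      · rw [norm_mul]
        exact mul_le_mul_of_nonneg_left (c0_norm_le g _) (norm_nonneg _)
      · have h1 : Tendsto (fun y => ‖f y‖ * ‖g‖) (𝓝 x) (𝓝 (‖f x‖ * ‖g‖)) :=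
          ((map_continuous f).norm.mul continuous_const).continuousAt
        simpa [hf x hx] using h1
  zero_at_infty' := by
    refine squeeze_zero_norm (a := fun y => ‖f y‖ * ‖g‖) (fun y => ?_) ?_
    · rw [norm_mul]
      exact mul_le_mul_of_nonneg_left (c0_norm_le g _) (norm_nonneg _)
    · simpa using ((zero_at_infty f).norm).mul_const ‖g‖

open Classical in
/-- `f ∘ e` on the source of `e`, extended by zero, for `f` vanishing off the target of `e`. -/
def pullC0 [T2Space X] (e : OpenPartialHomeomorph X X) (f : C₀(X, ℂ))
    (hf : ∀ x ∉ e.target, f x = 0) : C₀(X, ℂ) :=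
  have key : ∀ ε : ℝ, 0 < ε → ∃ K : Set X, IsCompact K ∧ K ⊆ e.source ∧
      ∀ x ∉ K, ‖if x ∈ e.source then f (e x) else 0‖ < ε := fun ε hε => by
    have hsub : {x | ε ≤ ‖f x‖} ⊆ e.target := by
      intro x hx
      by_contra h
      have hx' : ε ≤ ‖f x‖ := hx
      rw [hf x h, norm_zero] at hx'
      linarith
    refine ⟨e.symm '' {x | ε ≤ ‖f x‖}, (c0_compact f hε).image_of_continuousOn
      (e.continuousOn_symm.mono hsub), ?_, ?_⟩
    · rintro _ ⟨x, hx, rfl⟩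
      exact e.map_target (hsub hx)
    · intro x hx
      split_ifs with h
      · by_contra hlt
        exact hx ⟨e x, not_lt.1 hlt, e.left_inv h⟩
      · simpa using hε
  { toFun := fun x => if x ∈ e.source then f (e x) else 0
    continuous_toFun := by
      rw [continuous_iff_continuousAt]
      intro x
      by_cases hx : x ∈ e.source
      · have h1 : ContinuousAt (fun y => f (e y)) x :=
          (map_continuous f).continuousAt.comp (e.continuousAt hx)
        refine h1.congr ?_
        filter_upwards [e.open_source.mem_nhds hx] with y hy
        rw [if_pos hy]
      · change Tendsto _ _ (𝓝 (if x ∈ e.source then f (e x) else 0))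
        rw [if_neg hx, Metric.tendsto_nhds]
        intro ε hε
        obtain ⟨K, hK, hKs, hK'⟩ := key ε hε
        filter_upwards [hK.isClosed.isOpen_compl.mem_nhds (fun h => hx (hKs h))] with y hy
        rw [dist_zero_right]
        exact hK' y hy
    zero_at_infty' := by
      rw [Metric.tendsto_nhds]
      intro ε hε
      obtain ⟨K, hK, hKs, hK'⟩ := key ε hε
      filter_upwards [hK.compl_mem_cocompact] with y hy
      rw [dist_zero_right]
      exact hK' y hy }

theorem absC0_apply (f : C₀(X, ℂ)) (x : X) : absC0 f x = (‖f x‖ : ℂ) := rfl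

theorem twistMul_apply (e : OpenPartialHomeomorph X X) (f g : C₀(X, ℂ))
    (hf : ∀ x ∉ e.target, f x = 0) (x : X) : twistMul e f g hf x = f x * g (e.symm x) := rfl

theorem pullC0_of_mem [T2Space X] (e : OpenPartialHomeomorph X X) (f : C₀(X, ℂ))
    (hf : ∀ x ∉ e.target, f x = 0) {x : X} (hx : x ∈ e.source) :
    pullC0 e f hf x = f (e x) := if_pos hx

theorem pullC0_of_not_mem [T2Space X] (e : OpenPartialHomeomorph X X) (f : C₀(X, ℂ))
    (hf : ∀ x ∉ e.target, f x = 0) {x : X} (hx : x ∉ e.source) :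
    pullC0 e f hf x = 0 := if_neg hx

theorem c0_isClosed_vanishing (U : Set X) :
    IsClosed {f : C₀(X, ℂ) | ∀ x ∉ U, f x = 0} := by
  have hc : ∀ x : X, Continuous fun f : C₀(X, ℂ) => f x := fun x => by
    refine (LipschitzWith.of_dist_le_mul (K := 1) fun f g => ?_).continuous
    rw [dist_eq_norm, dist_eq_norm, NNReal.coe_one, one_mul]
    exact c0_norm_le (f - g) x
  have h : {f : C₀(X, ℂ) | ∀ x ∉ U, f x = 0} = ⋂ x ∈ Uᶜ, {f : C₀(X, ℂ) | f x = 0} := by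
    ext f; simp
  rw [h]
  exact isClosed_biInter fun x _ => isClosed_eq (hc x) continuous_const

/-- `C_0(U) ⊆ C_0(X)`: the functions vanishing off `U`. -/
def c0Sub (U : Set X) : Submodule ℂ C₀(X, ℂ) where
  carrier := {f | ∀ x ∉ U, f x = 0}
  add_mem' hf hg x hx := by simp [hf x hx, hg x hx]
  zero_mem' x _ := rfl
  smul_mem' c f hf x hx := by simp [hf x hx]

theorem mem_c0Sub {U : Set X} {f : C₀(X, ℂ)} : f ∈ c0Sub U ↔ ∀ x ∉ U, f x = 0 := Iff.rfl

theorem c0Sub_vanish {U : Set X} (f : c0Sub U) : ∀ x ∉ U, f.1 x = 0 := f.2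

theorem c0Sub_norm {U : Set X} (f : c0Sub U) : ‖f‖ = ‖f.1‖ := rfl

theorem c0Sub_norm_nonneg {U : Set X} (f : c0Sub U) : 0 ≤ ‖f‖ := norm_nonneg f.1

theorem completeSpace_c0Sub (U : Set X) : CompleteSpace (c0Sub U) :=
  IsComplete.completeSpace_coe (s := (c0Sub U : Set C₀(X, ℂ)))
    (c0_isClosed_vanishing U).isComplete

theorem c0Sub_ext {U : Set X} {f g : c0Sub U} (h : ∀ x, f.1 x = g.1 x) : f = g :=
  Subtype.ext (ZeroAtInftyContinuousMap.ext h)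

end C0

namespace PartialAction

variable {S : Type u} [InverseMonoid S] {X : Type u} [TopologicalSpace X]

/-- The multiplication `C_0(X_{s s*}) × C_0(X_{t t*}) → C_0(X_{st (st)*})`. -/
def fibMul (α : PartialAction S X) (s t : S) (f : c0Sub (α.act s).target)
    (g : c0Sub (α.act t).target) : c0Sub (α.act (s * t)).target :=
  ⟨twistMul (α.act s) f.1 g.1 (c0Sub_vanish f), mem_c0Sub.2 fun x hx => by
    rw [twistMul_apply]
    by_cases h : x ∈ (α.act s).target
    · rw [c0Sub_vanish g _ (fun h' => hx ((α.mem_target_mul s t x).2 ⟨h, h'⟩)), mul_zero]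
    · rw [c0Sub_vanish f x h, zero_mul]⟩

theorem fibMul_apply (α : PartialAction S X) (s t : S) (f : c0Sub (α.act s).target)
    (g : c0Sub (α.act t).target) (x : X) :
    (α.fibMul s t f g).1 x = f.1 x * g.1 ((α.act s).symm x) := rfl

theorem norm_fibMul_le (α : PartialAction S X) {s t : S} (f : c0Sub (α.act s).target)
    (g : c0Sub (α.act t).target) : ‖α.fibMul s t f g‖ ≤ ‖f‖ * ‖g‖ := by
  rw [c0Sub_norm, c0Sub_norm, c0Sub_norm]
  refine c0_norm_le_of _ (by positivity) fun x => ?_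
  rw [fibMul_apply, norm_mul]
  exact mul_le_mul (c0_norm_le _ _) (c0_norm_le _ _) (norm_nonneg _) (norm_nonneg _)

variable [T2Space X]

/-- The involution `C_0(X_{s s*}) → C_0(X_{s* s})`. -/
def fibStar (α : PartialAction S X) (s : S) (f : c0Sub (α.act s).target) :
    c0Sub (α.act s⁻¹).target :=
  ⟨Star.star (pullC0 (α.act s) f.1 (c0Sub_vanish f)), mem_c0Sub.2 fun x hx => by
    rw [α.target_inv] at hx
    rw [ZeroAtInftyContinuousMap.star_apply, pullC0_of_not_mem _ _ _ hx, star_zero]⟩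

theorem fibStar_of_mem (α : PartialAction S X) (s : S) (f : c0Sub (α.act s).target) {x : X}
    (hx : x ∈ (α.act s).source) : (α.fibStar s f).1 x = conj (f.1 (α.act s x)) := by
  change Star.star (pullC0 (α.act s) f.1 (c0Sub_vanish f) x) = _
  rw [pullC0_of_mem _ _ _ hx]; rfl

theorem fibStar_of_not_mem (α : PartialAction S X) (s : S) (f : c0Sub (α.act s).target) {x : X}
    (hx : x ∉ (α.act s).source) : (α.fibStar s f).1 x = 0 :=
  c0Sub_vanish (α.fibStar s f) x (by rwa [α.target_inv])

theorem norm_fibStar_le (α : PartialAction S X) {s : S} (f : c0Sub (α.act s).target) :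
    ‖α.fibStar s f‖ ≤ ‖f‖ := by
  rw [c0Sub_norm, c0Sub_norm]
  refine c0_norm_le_of _ (norm_nonneg _) fun x => ?_
  by_cases hx : x ∈ (α.act s).source
  · rw [α.fibStar_of_mem s f hx, RCLike.norm_conj]
    exact c0_norm_le _ _
  · rw [α.fibStar_of_not_mem s f hx, norm_zero]
    exact norm_nonneg _

theorem le_norm_fibStar_mul (α : PartialAction S X) {s : S} (f : c0Sub (α.act s).target) :
    ‖f‖ ^ 2 ≤ ‖α.fibMul s⁻¹ s (α.fibStar s f) f‖ := by
  have h : ‖f‖ ≤ Real.sqrt ‖α.fibMul s⁻¹ s (α.fibStar s f) f‖ := by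
    rw [c0Sub_norm f]
    refine c0_norm_le_of _ (Real.sqrt_nonneg _) fun x => ?_
    by_cases hx : x ∈ (α.act s).target
    · have hy := (α.act s).map_target hx
      refine Real.le_sqrt_of_sq_le ?_
      have := c0_norm_le (α.fibMul s⁻¹ s (α.fibStar s f) f).1 ((α.act s).symm x)
      rw [fibMul_apply, α.fibStar_of_mem s f hy, α.act_inv_symm_apply s hy,
        (α.act s).right_inv hx, norm_mul, RCLike.norm_conj, ← sq] at this
      exact this
    · rw [c0Sub_vanish f x hx, norm_zero]
      exact Real.sqrt_nonneg _
  calc ‖f‖ ^ 2 ≤ Real.sqrt ‖α.fibMul s⁻¹ s (α.fibStar s f) f‖ ^ 2 :=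
        pow_le_pow_left₀ (c0Sub_norm_nonneg _) h 2
    _ = _ := Real.sq_sqrt (c0Sub_norm_nonneg _)

/-- The Fell bundle of an action `α` of `S` on `X`: the fibre over `s` is
`C_0(X_{s s*}) ⊆ C_0(X)`, where `X_{s s*}` is the range of `α_s`, with
`(f δ_s)(g δ_t) = f · (g ∘ α_s⁻¹) δ_{st}` and `(f δ_s)* = (conj f ∘ α_s) δ_{s*}`. -/
def fellBundle (α : PartialAction S X) : FellBundle S where
  Fib s := c0Sub (α.act s).target
  complete s := completeSpace_c0Sub _
  mul {s t} := LinearMap.mk₂ ℂ (α.fibMul s t)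
    (fun f f' g => c0Sub_ext fun x => by
      rw [fibMul_apply]; exact add_mul (f.1 x) (f'.1 x) _)
    (fun c f g => c0Sub_ext fun x => by
      rw [fibMul_apply]; exact smul_mul_assoc c (f.1 x) _)
    (fun f g g' => c0Sub_ext fun x => by
      rw [fibMul_apply]; exact mul_add (f.1 x) _ _)
    (fun c f g => c0Sub_ext fun x => by
      rw [fibMul_apply]; exact mul_smul_comm c (f.1 x) _)
  star {s} :=
    { toFun := α.fibStar s
      map_add' := fun f g => c0Sub_ext fun x => by
        by_cases hx : x ∈ (α.act s).source
        · rw [α.fibStar_of_mem s _ hx]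
          change conj (f.1 _ + g.1 _) = (α.fibStar s f).1 x + (α.fibStar s g).1 x
          rw [map_add, α.fibStar_of_mem s _ hx, α.fibStar_of_mem s _ hx]
        · change _ = (α.fibStar s f).1 x + (α.fibStar s g).1 x
          simp only [α.fibStar_of_not_mem s _ hx, add_zero]
      map_smul' := fun c f => c0Sub_ext fun x => by
        by_cases hx : x ∈ (α.act s).source
        · rw [α.fibStar_of_mem s _ hx]
          change conj (c * f.1 _) = conj c * (α.fibStar s f).1 x
          rw [map_mul, α.fibStar_of_mem s _ hx]
        · change _ = conj c * (α.fibStar s f).1 x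
          simp only [α.fibStar_of_not_mem s _ hx, mul_zero] }
  incl {s t} h :=
    { toLinearMap := Submodule.inclusion
        (fun _ hf => mem_c0Sub.2 fun x hx =>
          mem_c0Sub.1 hf x fun h' => hx (α.natLE_target h h').1)
      norm_map' := fun f => rfl }
  norm_mul_le f g := α.norm_fibMul_le f g
  mul_assoc {s t r} f g k := c0Sub_ext fun x => by
    change f.1 x * g.1 ((α.act s).symm x) * k.1 ((α.act (s * t)).symm x) =
      f.1 x * (g.1 ((α.act s).symm x) * k.1 ((α.act t).symm ((α.act s).symm x)))
    by_cases hx : x ∈ (α.act (s * t)).target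
    · rw [α.act_mul_symm_apply s t hx, mul_assoc]
    · have h0 : f.1 x * g.1 ((α.act s).symm x) = 0 := c0Sub_vanish (α.fibMul s t f g) x hx
      rw [← mul_assoc, h0, zero_mul, zero_mul]
  norm_star {s} f := le_antisymm (α.norm_fibStar_le f) (by
    rcases eq_or_lt_of_le (c0Sub_norm_nonneg f) with h | h
    · rw [← h]; exact c0Sub_norm_nonneg _
    · have h1 := (α.le_norm_fibStar_mul f).trans (α.norm_fibMul_le _ _)
      rw [sq] at h1
      exact le_of_mul_le_mul_right h1 h)
  star_star {s} f := c0Sub_ext fun x => by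
    change (α.fibStar s⁻¹ (α.fibStar s f)).1 x = f.1 x
    by_cases hx : x ∈ (α.act s).target
    · rw [α.fibStar_of_mem _ _ (by rwa [α.source_inv]), α.act_inv_apply s hx,
        α.fibStar_of_mem _ _ ((α.act s).map_target hx), (α.act s).right_inv hx, RCLike.conj_conj]
    · rw [α.fibStar_of_not_mem _ _ (by rwa [α.source_inv]), c0Sub_vanish f x hx]
  star_mul {s t} f g := c0Sub_ext fun x => by
    change (α.fibStar (s * t) (α.fibMul s t f g)).1 x =
      (α.fibStar t g).1 x * (α.fibStar s f).1 ((α.act t⁻¹).symm x)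
    by_cases hx : x ∈ (α.act t).source
    · rw [α.act_inv_symm_apply t hx, α.fibStar_of_mem t g hx]
      by_cases hy : α.act t x ∈ (α.act s).source
      · have hst := (α.mem_source_mul s t x).2 ⟨hx, hy⟩
        rw [α.fibStar_of_mem _ _ hst, α.fibStar_of_mem _ _ hy, fibMul_apply,
          α.act_mul_apply s t hst, (α.act s).left_inv hy, map_mul, mul_comm]
      · rw [α.fibStar_of_not_mem _ _ hy, mul_zero,
          α.fibStar_of_not_mem _ _ (fun h => hy ((α.mem_source_mul s t x).1 h).2)]
    · rw [α.fibStar_of_not_mem _ _ hx, zero_mul,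
        α.fibStar_of_not_mem _ _ (fun h => hx ((α.mem_source_mul s t x).1 h).1)]
  norm_star_mul_self {s} f := le_antisymm
    ((α.norm_fibMul_le _ _).trans (by
      rw [sq]; exact mul_le_mul_of_nonneg_right (α.norm_fibStar_le f) (c0Sub_norm_nonneg _)))
    (α.le_norm_fibStar_mul f)
  star_mul_self_pos {s} f := by
    have habs : ∀ x ∉ (α.act s).target, absC0 f.1 x = 0 := fun x hx => by
      rw [absC0_apply, c0Sub_vanish f x hx, norm_zero, Complex.ofReal_zero]
    have hsrc : ∀ x, x ∈ (α.act s).source → x ∈ (α.act (s⁻¹ * s)).source := fun x hx =>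
      (α.mem_source_mul _ _ x).2 ⟨hx, by rw [α.source_inv]; exact (α.act s).map_source hx⟩
    have hid := idem_inv_mul s
    refine ⟨⟨pullC0 (α.act s) (absC0 f.1) habs, mem_c0Sub.2 fun x hx => ?_⟩, c0Sub_ext fun x => ?_⟩
    · refine pullC0_of_not_mem _ _ _ fun h => hx ?_
      have h1 := (α.act (s⁻¹ * s)).map_source (hsrc x h)
      rwa [α.act_idem hid (hsrc x h)] at h1
    · change (α.fibStar s f).1 x * f.1 ((α.act s⁻¹).symm x) =
        (α.fibStar (s⁻¹ * s) _).1 x *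
          pullC0 (α.act s) (absC0 f.1) habs ((α.act (s⁻¹ * s)⁻¹).symm x)
      by_cases hx : x ∈ (α.act s).source
      · rw [α.act_inv_symm_apply _ (hsrc x hx), α.fibStar_of_mem _ _ (hsrc x hx),
          α.act_idem hid (hsrc x hx), α.fibStar_of_mem _ _ hx, α.act_inv_symm_apply _ hx]
        change _ = conj (pullC0 (α.act s) (absC0 f.1) habs x) * _
        rw [pullC0_of_mem _ _ _ hx, absC0_apply, Complex.conj_ofReal, mul_comm,
          Complex.mul_conj, Complex.normSq_eq_norm_sq, sq, Complex.ofReal_mul]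
      · rw [α.fibStar_of_not_mem _ _ hx, zero_mul,
          α.fibStar_of_not_mem _ _ (fun h => hx ((α.mem_source_mul _ _ x).1 h).1), zero_mul]
  incl_refl f := rfl
  incl_trans h h' f := rfl
  incl_mul {s s' t t'} h h' f g := c0Sub_ext fun x => by
    change f.1 x * g.1 ((α.act s').symm x) = f.1 x * g.1 ((α.act s).symm x)
    by_cases hx : x ∈ (α.act s).target
    · rw [(α.natLE_target h hx).2]
    · rw [c0Sub_vanish f x hx, zero_mul, zero_mul]
  incl_star {s t} h f := c0Sub_ext fun x => by
    change (α.fibStar t _).1 x = (α.fibStar s f).1 x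
    by_cases hx : x ∈ (α.act s).source
    · obtain ⟨h1, h2⟩ := α.natLE_source h hx
      rw [α.fibStar_of_mem _ _ hx, α.fibStar_of_mem _ _ h1, h2]; rfl
    · rw [α.fibStar_of_not_mem _ _ hx]
      by_cases hx' : x ∈ (α.act t).source
      · rw [α.fibStar_of_mem _ _ hx']
        change conj (f.1 (α.act t x)) = 0
        rw [c0Sub_vanish f _ ?_, map_zero]
        intro hy
        have h3 := (α.act s).map_target hy
        have h4 := (α.natLE_target h hy).2
        rw [(α.act t).left_inv hx'] at h4
        rw [← h4] at h3
        exact hx h3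
      · rw [α.fibStar_of_not_mem _ _ hx']

/-- An action on a space has the approximation property if its Fell bundle has it. -/
def HasApproximationProperty (α : PartialAction S X) : Prop :=
  α.fellBundle.ApproximationProperty

end PartialAction

/-! ### Topological groupoids -/

/-- A topological groupoid, given by its space of arrows `G`. A unit is identified with the
corresponding identity arrow; `mul g h` is meaningful only if `src g = rng h`. -/
class TopGroupoid (G : Type u) [TopologicalSpace G] where
  src : G → G
  rng : G → G
  mul : G → G → G
  inv : G → G
  src_src : ∀ g, src (src g) = src g
  rng_src : ∀ g, rng (src g) = src g
  src_rng : ∀ g, src (rng g) = rng g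
  rng_rng : ∀ g, rng (rng g) = rng g
  src_mul : ∀ g h, src g = rng h → src (mul g h) = src h
  rng_mul : ∀ g h, src g = rng h → rng (mul g h) = rng g
  mul_assoc : ∀ g h k, src g = rng h → src h = rng k → mul (mul g h) k = mul g (mul h k)
  mul_src : ∀ g, mul g (src g) = g
  rng_mul_self : ∀ g, mul (rng g) g = g
  src_inv : ∀ g, src (inv g) = rng g
  rng_inv : ∀ g, rng (inv g) = src g
  inv_mul : ∀ g, mul (inv g) g = src g
  mul_inv : ∀ g, mul g (inv g) = rng g
  continuous_inv : Continuous inv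
  continuousOn_mul : ContinuousOn (fun p : G × G => mul p.1 p.2) {p | src p.1 = rng p.2}

namespace TopGroupoid

section Basic

variable {G : Type u} [TopologicalSpace G] [TopGroupoid G]

variable (G) in
/-- The unit space `G⁰`, with the subspace topology. -/
def UnitSpace : Type u := {x : G // src x = x}

instance : TopologicalSpace (UnitSpace G) := inferInstanceAs (TopologicalSpace {x : G // src x = x})

/-- The source map `G → G⁰`. -/
def source (g : G) : UnitSpace G := ⟨src g, src_src g⟩

/-- The range map `G → G⁰`. -/
def range (g : G) : UnitSpace G := ⟨rng g, src_rng g⟩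

theorem source_eq_iff {g h : G} : source g = source h ↔ src g = src h := Subtype.ext_iff

theorem range_eq_iff {g h : G} : range g = range h ↔ rng g = rng h := Subtype.ext_iff

theorem source_eq_range_iff {g h : G} : source g = range h ↔ src g = rng h := Subtype.ext_iff

theorem rng_of_unit {x : G} (hx : src x = x) : rng x = x := by
  rw [← hx, rng_src]

theorem inv_inv_self (g : G) : inv (inv g) = g := by
  calc inv (inv g) = mul (inv (inv g)) (src (inv (inv g))) := (mul_src _).symm
    _ = mul (inv (inv g)) (mul (inv g) g) := by rw [src_inv, rng_inv, inv_mul]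
    _ = mul (mul (inv (inv g)) (inv g)) g := by
        rw [mul_assoc _ _ _ (src_inv _) (src_inv _)]
    _ = mul (rng g) g := by rw [inv_mul, src_inv]
    _ = g := rng_mul_self g

theorem inv_mul_cancel_left {g h : G} (hgh : src g = rng h) : mul (inv g) (mul g h) = h := by
  rw [← mul_assoc _ _ _ (src_inv g) hgh, inv_mul, hgh, rng_mul_self]

theorem mul_inv_cancel_left {g h : G} (hgh : rng g = rng h) : mul g (mul (inv g) h) = h := by
  rw [← mul_assoc _ _ _ (rng_inv g).symm (by rw [src_inv, hgh]), mul_inv, hgh, rng_mul_self]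

theorem mul_mul_inv_rev {g h : G} (hgh : src g = rng h) : mul (mul g h) (inv h) = g := by
  rw [mul_assoc _ _ _ hgh (rng_inv h).symm, mul_inv, ← hgh, mul_src]

theorem continuous_src : Continuous (src : G → G) := by
  have h : (src : G → G) = fun g => mul (inv g) g := funext fun g => (inv_mul g).symm
  rw [h]
  exact continuousOn_mul.comp_continuous (continuous_inv.prodMk continuous_id)
    fun g => src_inv g

theorem continuous_rng : Continuous (rng : G → G) := by
  have h : (rng : G → G) = fun g => src (inv g) := funext fun g => (src_inv g).symm
  rw [h]
  exact continuous_src.comp continuous_inv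

theorem continuous_source : Continuous (source : G → UnitSpace G) := continuous_src.subtype_mk _

theorem continuous_range : Continuous (range : G → UnitSpace G) := continuous_rng.subtype_mk _

/-- Open bisections: open sets on which `s` and `r` are homeomorphisms onto open subsets of `G⁰`. -/
structure IsOpenBisection (u : Set G) : Prop where
  isOpen : IsOpen u
  source_openEmbedding : IsOpenEmbedding (fun g : u => source g.1)
  range_openEmbedding : IsOpenEmbedding (fun g : u => range g.1)

theorem IsOpenBisection.src_inj {u : Set G} (hu : IsOpenBisection u) {g h : G} (hg : g ∈ u)
    (hh : h ∈ u) (e : src g = src h) : g = h :=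
  congrArg Subtype.val (hu.source_openEmbedding.injective
    (a₁ := ⟨g, hg⟩) (a₂ := ⟨h, hh⟩) (source_eq_iff.2 e))

theorem IsOpenBisection.rng_inj {u : Set G} (hu : IsOpenBisection u) {g h : G} (hg : g ∈ u)
    (hh : h ∈ u) (e : rng g = rng h) : g = h :=
  congrArg Subtype.val (hu.range_openEmbedding.injective
    (a₁ := ⟨g, hg⟩) (a₂ := ⟨h, hh⟩) (range_eq_iff.2 e))

end Basic

/-- A topological groupoid is étale if its open bisections form a basis of its topology. -/
class IsEtale (G : Type u) [TopologicalSpace G] [TopGroupoid G] : Prop where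
  isTopologicalBasis : TopologicalSpace.IsTopologicalBasis {u : Set G | IsOpenBisection u}

section Etale

variable {G : Type u} [TopologicalSpace G] [TopGroupoid G] [IsEtale G]

theorem exists_bisection (g : G) {W : Set G} (hW : IsOpen W) (hg : g ∈ W) :
    ∃ u, IsOpenBisection u ∧ g ∈ u ∧ u ⊆ W := by
  obtain ⟨u, hu, h1, h2⟩ := (IsEtale.isTopologicalBasis (G := G)).exists_subset_of_mem_open hg hW
  exact ⟨u, hu, h1, h2⟩

theorem isOpenMap_of_bisection {f : G → UnitSpace G}
    (hf : ∀ u : Set G, IsOpenBisection u → IsOpenMap (fun g : u => f g.1)) : IsOpenMap f := by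
  intro W hW
  rw [isOpen_iff_mem_nhds]
  rintro _ ⟨g, hg, rfl⟩
  obtain ⟨u, hu, hgu, huW⟩ := exists_bisection g hW hg
  refine mem_of_superset ((hf u hu).isOpen_range.mem_nhds ⟨⟨g, hgu⟩, rfl⟩) ?_
  rintro _ ⟨h, rfl⟩
  exact ⟨h.1, huW h.2, rfl⟩

theorem isOpenMap_source : IsOpenMap (source : G → UnitSpace G) :=
  isOpenMap_of_bisection fun _ hu => hu.source_openEmbedding.isOpenMap

theorem isOpenMap_range : IsOpenMap (range : G → UnitSpace G) :=
  isOpenMap_of_bisection fun _ hu => hu.range_openEmbedding.isOpenMap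

theorem isOpenBisection_of {u : Set G} (ho : IsOpen u)
    (hs : ∀ g ∈ u, ∀ h ∈ u, src g = src h → g = h)
    (hr : ∀ g ∈ u, ∀ h ∈ u, rng g = rng h → g = h) : IsOpenBisection u where
  isOpen := ho
  source_openEmbedding := IsOpenEmbedding.of_continuous_injective_isOpenMap
    (continuous_source.comp continuous_subtype_val)
    (fun g h e => Subtype.ext (hs g.1 g.2 h.1 h.2 (source_eq_iff.1 e)))
    (isOpenMap_source.comp ho.isOpenMap_subtype_val)
  range_openEmbedding := IsOpenEmbedding.of_continuous_injective_isOpenMap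
    (continuous_range.comp continuous_subtype_val)
    (fun g h e => Subtype.ext (hr g.1 g.2 h.1 h.2 (range_eq_iff.1 e)))
    (isOpenMap_range.comp ho.isOpenMap_subtype_val)

/-- The product `u · v = {gh : g ∈ u, h ∈ v, s(g) = r(h)}`. -/
def setMul (u v : Set G) : Set G := {k | ∃ g ∈ u, ∃ h ∈ v, src g = rng h ∧ mul g h = k}

theorem isOpenBisection_units : IsOpenBisection {x : G | src x = x} := by
  refine isOpenBisection_of ?_ ?_ ?_
  · rw [isOpen_iff_mem_nhds]
    intro x hx
    obtain ⟨u, hu, hxu, -⟩ := exists_bisection x isOpen_univ (Set.mem_univ x)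
    have h1 : IsOpen (u ∩ src ⁻¹' u) := hu.isOpen.inter (hu.isOpen.preimage continuous_src)
    refine mem_of_superset (h1.mem_nhds ⟨hxu, ?_⟩) ?_
    · change src x ∈ u
      rwa [show src x = x from hx]
    · rintro g ⟨hg, hg'⟩
      exact hu.src_inj hg' hg (src_src g)
  · intro g hg h hh e
    rwa [show src g = g from hg, show src h = h from hh] at e
  · intro g hg h hh e
    rwa [rng_of_unit hg, rng_of_unit hh] at e

theorem isOpenBisection_inv {u : Set G} (hu : IsOpenBisection u) :
    IsOpenBisection {g : G | inv g ∈ u} := by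
  refine isOpenBisection_of (hu.isOpen.preimage continuous_inv) ?_ ?_
  · intro g hg h hh e
    have := hu.rng_inj hg hh (by rw [rng_inv, rng_inv, e])
    rw [← inv_inv_self g, this, inv_inv_self]
  · intro g hg h hh e
    have := hu.src_inj hg hh (by rw [src_inv, src_inv, e])
    rw [← inv_inv_self g, this, inv_inv_self]

theorem isOpen_setMul {u v : Set G} (hu : IsOpenBisection u) (hv : IsOpenBisection v) :
    IsOpen (setMul u v) := by
  rw [isOpen_iff_mem_nhds]
  rintro k ⟨g, hg, h, hh, hgh, rfl⟩
  have hne : Nonempty u := ⟨⟨g, hg⟩⟩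
  let e := hu.range_openEmbedding.toOpenPartialHomeomorph (fun g : u => range g.1)
  have het : e.target = Set.range (fun g : u => range g.1) := by simp [e]
  have hes : ∀ x ∈ e.target, range (e.symm x).1 = x := fun x hx => e.right_inv hx
  set W : Set G := range ⁻¹' e.target with hW
  have hWo : IsOpen W := e.open_target.preimage continuous_range
  have hc : ContinuousOn (fun k : G => mul (inv (e.symm (range k)).1) k) W := by
    refine continuousOn_mul.comp (f := fun k : G => (inv (e.symm (range k)).1, k)) ?_ ?_
    · refine ContinuousOn.prodMk ?_ continuousOn_id
      refine (continuous_inv.comp continuous_subtype_val).comp_continuousOn ?_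
      exact e.continuousOn_symm.comp continuous_range.continuousOn fun x hx => hx
    · intro k hk
      change src (inv (e.symm (range k)).1) = rng k
      rw [src_inv]
      exact range_eq_iff.1 (hes _ hk)
  have hopen := hc.isOpen_inter_preimage hWo hv.isOpen
  have hgk : range (mul g h) = range g := range_eq_iff.2 (rng_mul g h hgh)
  have hkW : mul g h ∈ W := by
    change range (mul g h) ∈ e.target
    rw [hgk, het]
    exact ⟨⟨g, hg⟩, rfl⟩
  have hsec : ((e.symm (range (mul g h))).1 : G) = g := by
    refine hu.rng_inj (e.symm _).2 hg ?_
    rw [range_eq_iff.1 (hes _ hkW), rng_mul g h hgh]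
  refine mem_of_superset (hopen.mem_nhds ⟨hkW, ?_⟩) ?_
  · change mul (inv (e.symm (range (mul g h))).1) (mul g h) ∈ v
    rw [hsec, inv_mul_cancel_left hgh]
    exact hh
  · rintro k ⟨hk, hkv⟩
    have hr : rng (e.symm (range k)).1 = rng k := range_eq_iff.1 (hes _ hk)
    refine ⟨(e.symm (range k)).1, (e.symm (range k)).2, _, hkv, ?_, mul_inv_cancel_left hr⟩
    rw [rng_mul _ _ (by rw [src_inv, hr]), rng_inv]

theorem isOpenBisection_mul {u v : Set G} (hu : IsOpenBisection u) (hv : IsOpenBisection v) :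
    IsOpenBisection (setMul u v) := by
  refine isOpenBisection_of (isOpen_setMul hu hv) ?_ ?_
  · rintro _ ⟨g, hg, h, hh, e, rfl⟩ _ ⟨g', hg', h', hh', e', rfl⟩ E
    rw [src_mul _ _ e, src_mul _ _ e'] at E
    obtain rfl := hv.src_inj hh hh' E
    obtain rfl := hu.src_inj hg hg' (e.trans e'.symm)
    rfl
  · rintro _ ⟨g, hg, h, hh, e, rfl⟩ _ ⟨g', hg', h', hh', e', rfl⟩ E
    rw [rng_mul _ _ e, rng_mul _ _ e'] at E
    obtain rfl := hu.rng_inj hg hg' E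
    obtain rfl := hv.rng_inj hh hh' (e.symm.trans e')
    rfl

variable (G) in
/-- `Bis(G)`: the open bisections of `G`. -/
def Bis : Type u := {u : Set G // IsOpenBisection u}

theorem setMul_inv_setMul {u t : Set G} (hu : IsOpenBisection u)
    (h : setMul (setMul u t) u = u) {g : G} (hg : g ∈ u) : inv g ∈ t := by
  have hg' := hg
  rw [← h] at hg'
  obtain ⟨_, ⟨a, ha, b, hb, hab, rfl⟩, c, hc, habc, he⟩ := hg'
  rw [src_mul _ _ hab] at habc
  have hab' : src (mul a b) = rng c := by rw [src_mul _ _ hab, habc]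
  have hcg : c = g := hu.src_inj hc hg (by rw [← he, src_mul _ _ hab'])
  have hag : a = g := hu.rng_inj ha hg (by rw [← he, rng_mul _ _ hab', rng_mul _ _ hab])
  subst hcg
  subst hag
  have h1 : mul (mul (mul a b) a) (inv a) = mul a b := mul_mul_inv_rev hab'
  rw [he] at h1
  have h2 : mul (inv a) (mul a b) = b := inv_mul_cancel_left hab
  rw [← h1, mul_inv, ← src_inv, mul_src] at h2
  rwa [h2]

theorem setMul_inv_self (u : Set G) (hu : IsOpenBisection u) :
    setMul (setMul u {g | inv g ∈ u}) u = u := by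
  ext k
  constructor
  · rintro ⟨_, ⟨a, ha, b, hb, hab, rfl⟩, c, hc, habc, rfl⟩
    rw [src_mul _ _ hab] at habc
    have h1 : inv b = a := hu.src_inj hb ha (by rw [src_inv, hab])
    have h2 : inv b = c := hu.rng_inj hb hc (by rw [rng_inv, habc])
    have h3 : c = a := h2.symm.trans h1
    subst h3
    have h4 : b = inv c := by rw [← h1, inv_inv_self]
    subst h4
    rwa [mul_inv, rng_mul_self]
  · intro hk
    refine ⟨rng k, ⟨k, hk, inv k, ?_, (rng_inv k).symm, mul_inv k⟩, k, hk, src_rng k,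
      rng_mul_self k⟩
    change inv (inv k) ∈ u
    rwa [inv_inv_self]

theorem setOf_inv_inv (u : Set G) : {g : G | inv g ∈ {h : G | inv h ∈ u}} = u := by
  ext g
  change inv (inv g) ∈ u ↔ g ∈ u
  rw [inv_inv_self]

/-- `Bis(G)` is an inverse semigroup with unit `G⁰`. -/
instance : InverseMonoid (Bis G) where
  mul u v := ⟨setMul u.1 v.1, isOpenBisection_mul u.2 v.2⟩
  one := ⟨{x | src x = x}, isOpenBisection_units⟩
  inv u := ⟨{g | inv g ∈ u.1}, isOpenBisection_inv u.2⟩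
  mul_assoc u v w := Subtype.ext (Set.ext fun k => by
    constructor
    · rintro ⟨_, ⟨a, ha, b, hb, hab, rfl⟩, c, hc, habc, rfl⟩
      rw [src_mul _ _ hab] at habc
      exact ⟨a, ha, _, ⟨b, hb, c, hc, habc, rfl⟩, by rw [rng_mul _ _ habc, hab],
        (mul_assoc _ _ _ hab habc).symm⟩
    · rintro ⟨a, ha, _, ⟨b, hb, c, hc, hbc, rfl⟩, habc, rfl⟩
      rw [rng_mul _ _ hbc] at habc
      exact ⟨_, ⟨a, ha, b, hb, habc, rfl⟩, c, hc, by rw [src_mul _ _ habc, hbc],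
        mul_assoc _ _ _ habc hbc⟩)
  one_mul u := Subtype.ext (Set.ext fun k => by
    constructor
    · rintro ⟨a, ha, b, hb, hab, rfl⟩
      rw [show a = rng b from (show src a = a from ha).symm.trans hab, rng_mul_self]
      exact hb
    · intro hk
      exact ⟨rng k, src_rng k, k, hk, src_rng k, rng_mul_self k⟩)
  mul_one u := Subtype.ext (Set.ext fun k => by
    constructor
    · rintro ⟨a, ha, b, hb, hab, rfl⟩
      rw [show b = src a from (rng_of_unit hb).symm.trans hab.symm, mul_src]
      exact ha
    · intro hk
      exact ⟨k, hk, src k, src_src k, (rng_src k).symm, mul_src k⟩)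
  mul_inv_mul_self u := Subtype.ext (setMul_inv_self u.1 u.2)
  inv_mul_inv_self u := Subtype.ext (by
    have h := setMul_inv_self _ (isOpenBisection_inv u.2)
    rw [setOf_inv_inv] at h
    exact h)
  inv_unique u t h h' := Subtype.ext (Set.ext fun g => by
    constructor
    · intro hg
      exact setMul_inv_setMul t.2 (congrArg Subtype.val h') hg
    · intro hg
      have := setMul_inv_setMul u.2 (congrArg Subtype.val h) (show inv g ∈ u.1 from hg)
      rwa [inv_inv_self] at this)

/-! ### The canonical action on the unit space -/

open Classical in
/-- `x ↦ u x`: if `g ∈ u` has source `x`, then `u x = r(g)` (and junk if there is no such `g`). -/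
def bisFun (u : Bis G) (x : UnitSpace G) : UnitSpace G :=
  if h : ∃ g ∈ u.1, source g = x then range h.choose else x

theorem bisFun_source (u : Bis G) {g : G} (hg : g ∈ u.1) : bisFun u (source g) = range g := by
  have h : ∃ g' ∈ u.1, source g' = source g := ⟨g, hg, rfl⟩
  rw [bisFun, dif_pos h]
  rw [u.2.src_inj h.choose_spec.1 hg (source_eq_iff.1 h.choose_spec.2)]

theorem mem_inv_iff (u : Bis G) (g : G) : g ∈ (u⁻¹).1 ↔ inv g ∈ u.1 := Iff.rfl

theorem inv_mem_inv (u : Bis G) {g : G} (hg : g ∈ u.1) : inv g ∈ (u⁻¹).1 := by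
  rwa [mem_inv_iff, inv_inv_self]

theorem source_inv (g : G) : source (inv g) = range g := Subtype.ext (src_inv g)

theorem range_inv (g : G) : range (inv g) = source g := Subtype.ext (rng_inv g)

theorem bisFun_inv_range (u : Bis G) {g : G} (hg : g ∈ u.1) :
    bisFun u⁻¹ (range g) = source g := by
  rw [← source_inv, bisFun_source _ (inv_mem_inv u hg), range_inv]

theorem continuousOn_bisFun (u : Bis G) : ContinuousOn (bisFun u) (source '' u.1) := by
  rw [continuousOn_iff']
  intro W hW
  refine ⟨source '' (u.1 ∩ range ⁻¹' W),
    isOpenMap_source _ (u.2.isOpen.inter (hW.preimage continuous_range)), ?_⟩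
  ext x
  constructor
  · rintro ⟨hx, g, hg, rfl⟩
    refine ⟨⟨g, ⟨hg, ?_⟩, rfl⟩, g, hg, rfl⟩
    rwa [Set.mem_preimage, bisFun_source u hg] at hx
  · rintro ⟨⟨g, ⟨hg, hgW⟩, rfl⟩, -⟩
    refine ⟨?_, g, hg, rfl⟩
    rwa [Set.mem_preimage, bisFun_source u hg]

theorem source_image_inv (u : Bis G) : source '' (u⁻¹).1 = range '' u.1 := by
  ext x
  constructor
  · rintro ⟨g, hg, rfl⟩
    exact ⟨inv g, hg, range_inv g⟩
  · rintro ⟨g, hg, rfl⟩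
    exact ⟨inv g, inv_mem_inv u hg, source_inv g⟩

/-- The partial homeomorphism `s(u) → r(u)` of `G⁰` given by an open bisection `u`. -/
def bisHomeo (u : Bis G) : OpenPartialHomeomorph (UnitSpace G) (UnitSpace G) where
  toFun := bisFun u
  invFun := bisFun u⁻¹
  source := source '' u.1
  target := range '' u.1
  map_source' := by
    rintro _ ⟨g, hg, rfl⟩
    rw [bisFun_source u hg]
    exact ⟨g, hg, rfl⟩
  map_target' := by
    rintro _ ⟨g, hg, rfl⟩
    rw [bisFun_inv_range u hg]
    exact ⟨g, hg, rfl⟩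
  left_inv' := by
    rintro _ ⟨g, hg, rfl⟩
    rw [bisFun_source u hg, bisFun_inv_range u hg]
  right_inv' := by
    rintro _ ⟨g, hg, rfl⟩
    rw [bisFun_inv_range u hg, bisFun_source u hg]
  open_source := isOpenMap_source _ u.2.isOpen
  open_target := isOpenMap_range _ u.2.isOpen
  continuousOn_toFun := continuousOn_bisFun u
  continuousOn_invFun := by
    have h := continuousOn_bisFun u⁻¹
    rwa [source_image_inv] at h

variable (G) in
/-- The canonical action of `Bis(G)` on `G⁰`. -/
def canonicalAction : PartialAction (Bis G) (UnitSpace G) where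
  act := bisHomeo
  act_one := by
    have hone : ∀ x : UnitSpace G, x.1 ∈ (1 : Bis G).1 ∧ source x.1 = x ∧ range x.1 = x :=
      fun x => ⟨x.2, Subtype.ext x.2, Subtype.ext (rng_of_unit x.2)⟩
    refine ⟨?_, ?_⟩
    · ext x
      exact ⟨fun _ => Set.mem_univ _, fun _ => ⟨x.1, (hone x).1, (hone x).2.1⟩⟩
    · intro x _
      change bisFun 1 x = x
      have := bisFun_source 1 (hone x).1
      rwa [(hone x).2.1, (hone x).2.2] at this
  act_mul u v := by
    have key : ∀ g ∈ u.1, ∀ h ∈ v.1, src g = rng h →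
        bisFun (u * v) (source h) = range g := fun g hg h hh e => by
      have hm : mul g h ∈ (u * v).1 := ⟨g, hg, h, hh, e, rfl⟩
      have := bisFun_source (u * v) hm
      rwa [show source (mul g h) = source h from Subtype.ext (src_mul g h e),
        show range (mul g h) = range g from Subtype.ext (rng_mul g h e)] at this
    refine ⟨?_, ?_⟩
    · ext x
      change x ∈ source '' (u * v).1 ↔ x ∈ (source '' v.1) ∩ bisFun v ⁻¹' (source '' u.1)
      constructor
      · rintro ⟨_, ⟨g, hg, h, hh, e, rfl⟩, rfl⟩
        rw [show source (mul g h) = source h from Subtype.ext (src_mul g h e)]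
        refine ⟨⟨h, hh, rfl⟩, ?_⟩
        rw [Set.mem_preimage, bisFun_source v hh]
        exact ⟨g, hg, source_eq_range_iff.2 e⟩
      · rintro ⟨⟨h, hh, rfl⟩, hx⟩
        rw [Set.mem_preimage, bisFun_source v hh] at hx
        obtain ⟨g, hg, e⟩ := hx
        have e' := source_eq_range_iff.1 e
        exact ⟨mul g h, ⟨g, hg, h, hh, e', rfl⟩, Subtype.ext (src_mul g h e')⟩
    · rintro _ ⟨_, ⟨g, hg, h, hh, e, rfl⟩, rfl⟩
      change bisFun (u * v) (source (mul g h)) = bisFun u (bisFun v (source (mul g h)))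
      rw [show source (mul g h) = source h from Subtype.ext (src_mul g h e), key g hg h hh e,
        bisFun_source v hh, ← source_eq_range_iff.2 e, bisFun_source u hg]
  act_inv u := by
    refine ⟨source_image_inv u, fun x _ => rfl⟩

/-- An inverse subsemigroup `S ⊆ Bis(G)` is wide if it covers `G` and `u ∩ v`, for `u, v ∈ S`, is a
union of elements of `S`. (If a wide `S` has a unit, this unit is `G⁰`.) -/
def IsWide (S : InverseSubsemigroup (Bis G)) : Prop :=
  (∀ g : G, ∃ u ∈ S.carrier, g ∈ u.1) ∧
  ∀ g : G, ∀ u ∈ S.carrier, ∀ v ∈ S.carrier, g ∈ u.1 ∩ v.1 →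
    ∃ w ∈ S.carrier, g ∈ w.1 ∧ w.1 ⊆ u.1 ∩ v.1

end Etale

/-- The canonical action of `S ⊆ Bis(G)` on `G⁰`. If `S` has no unit, a unit acting as the identity
is adjoined to `S`; for wide `S` this unit is the element `G⁰` of `Bis(G)`. -/
def canonicalActionOf {G : Type u} [TopologicalSpace G] [TopGroupoid G] [IsEtale G]
    (S : InverseSubsemigroup (Bis G)) : PartialAction S.unitize.Elem (UnitSpace G) :=
  (canonicalAction G).restrict S.unitize

/-! ### Topological amenability -/

section Amenable

variable (G : Type u) [TopologicalSpace G] [TopGroupoid G]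

/-- `C_c(G)`: the span of the functions that are continuous on some open bisection and vanish off
a compact subset of it. -/
def CompactlySupported : Submodule ℂ (G → ℂ) :=
  Submodule.span ℂ {f | ∃ u : Set G, IsOpenBisection u ∧ ContinuousOn f u ∧
    ∃ K ⊆ u, IsCompact K ∧ ∀ g ∉ K, f g = 0}

/-- Topological amenability of an étale groupoid. -/
def IsTopologicallyAmenable : Prop :=
  ∃ (I : Type u) (_ : Preorder I) (_ : IsDirectedOrder I) (_ : Nonempty I) (η : I → G → ℂ),
    (∀ i, η i ∈ CompactlySupported G) ∧
    (∀ i, ∀ x : UnitSpace G, Real.sqrt (∑ᶠ h : {h : G // range h = x}, ‖η i h‖ ^ 2) ≤ 1) ∧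
    ∀ K : Set G, IsCompact K → TendstoUniformlyOn
      (fun i g => ∑ᶠ h : {h : G // range h = range g}, conj (η i h) * η i (mul (inv g) h))
      (fun _ => 1) atTop K

end Amenable

end TopGroupoid

end InvFell

end

/-!
A section `ξ` of the Fell bundle with finite support is the function `η = ∑ₚ (ξₚ ∘ r) 1ₚ` on `G`.
In the bidual of `C₀(X)` the unit `1ₛ` acts as the characteristic function of the open set of those
`x ∈ X = G⁰` that belong to the bisection `s`. By inner regularity of functionals on `C₀(X)`, the
bidual norm of `∑ᵢ 1_{Uᵢ} cᵢ - a` is the supremum norm of this function on `X`. The two conditions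
of the approximation property therefore say that `∑_{r(h) = x} |η h|²` is bounded and that the
coefficients `k ↦ ∑_{r(h) = r(k)} conj (η h) η (k⁻¹ h)` tend to `1` after multiplication by any
`f ∘ r` with `f ∈ C₀(r(s))`, uniformly on the bisection `s`.

If `G` is amenable, a partition of unity writes functions in `C_c(G)` as such `η`. Conversely, soft
thresholding makes the supports of the `ξₚ` compact at the cost of a small error; a cut-off and a
rescaling near `1` restore the bound `∑_{r(h) = x} |η h|² ≤ 1`.
-/

noncomputable section

open Filter Topology
open scoped ZeroAtInfty CompactlySupported ComplexConjugate

namespace InvFell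

universe u

/-! ### Functions vanishing at infinity -/

section SoftThreshold

variable {E : Type*} [NormedAddCommGroup E] [NormedSpace ℝ E] {δ : ℝ}

/-- The soft threshold: `z` minus its radial projection to the ball of radius `δ`. It moves no
point by more than `δ` and kills the ball. -/
def softThreshold (δ : ℝ) (z : E) : E := z - (δ / max δ ‖z‖) • z

theorem continuous_softThreshold (hδ : 0 < δ) : Continuous (softThreshold δ : E → E) :=
  continuous_id.sub ((continuous_const.div (by fun_prop) fun _ =>
    (lt_max_of_lt_left hδ).ne').smul continuous_id)

theorem softThreshold_of_norm_le (hδ : 0 < δ) {z : E} (hz : ‖z‖ ≤ δ) : softThreshold δ z = 0 := by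
  simp [softThreshold, max_eq_left hz, div_self hδ.ne']

theorem norm_sub_softThreshold_le (hδ : 0 < δ) (z : E) : ‖z - softThreshold δ z‖ ≤ δ := by
  rw [softThreshold, sub_sub_cancel, norm_smul, Real.norm_of_nonneg (by positivity),
    div_mul_eq_mul_div, div_le_iff₀ (lt_max_of_lt_left hδ)]
  gcongr
  exact le_max_right _ _

theorem norm_softThreshold_le (hδ : 0 < δ) (z : E) : ‖softThreshold δ z‖ ≤ ‖z‖ := by
  have h : δ / max δ ‖z‖ ≤ 1 := (div_le_one (lt_max_of_lt_left hδ)).2 (le_max_left _ _)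
  have h' : 0 ≤ δ / max δ ‖z‖ := by positivity
  have hsmul : softThreshold δ z = (1 - δ / max δ ‖z‖) • z := by rw [sub_smul, one_smul]; rfl
  rw [hsmul, norm_smul, Real.norm_of_nonneg (sub_nonneg.2 h)]
  exact mul_le_of_le_one_left (norm_nonneg _) (by linarith)

end SoftThreshold

section C0

variable {X : Type u} [TopologicalSpace X] {U : Set X} {δ : ℝ}

/-- The soft threshold of a function vanishing at infinity. -/
def softC0 (δ : ℝ) (hδ : 0 < δ) (f : C₀(X, ℂ)) : C₀(X, ℂ) where
  toFun x := softThreshold δ (f x)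
  continuous_toFun := (continuous_softThreshold hδ).comp (map_continuous f)
  zero_at_infty' := squeeze_zero_norm (fun x => norm_softThreshold_le hδ (f x))
    (by simpa using (zero_at_infty f).norm)

theorem norm_sub_softC0_le (hδ : 0 < δ) (f : C₀(X, ℂ)) : ‖f - softC0 δ hδ f‖ ≤ δ :=
  c0_norm_le_of _ hδ.le fun x => norm_sub_softThreshold_le hδ (f x)

theorem norm_softC0_le (hδ : 0 < δ) (f : C₀(X, ℂ)) : ‖softC0 δ hδ f‖ ≤ ‖f‖ :=
  c0_norm_le_of _ (norm_nonneg f) fun x =>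
    (norm_softThreshold_le hδ (f x)).trans (c0_norm_le f x)

theorem softC0_mem_c0Sub_setOf_le_norm (hδ : 0 < δ) (f : C₀(X, ℂ)) :
    softC0 δ hδ f ∈ c0Sub {x | δ ≤ ‖f x‖} :=
  fun _ hx => softThreshold_of_norm_le hδ (not_le.1 hx).le

theorem setOf_le_norm_subset (hδ : 0 < δ) {f : C₀(X, ℂ)} (hf : f ∈ c0Sub U) :
    {x | δ ≤ ‖f x‖} ⊆ U := fun x hx => by
  by_contra hxU
  exact hδ.not_ge (by simpa [hf x hxU] using hx)

theorem c0Sub_mono {V : Set X} (hUV : U ⊆ V) : (c0Sub U : Submodule ℂ C₀(X, ℂ)) ≤ c0Sub V :=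
  fun _ hf x hx => hf x fun h => hx (hUV h)

theorem softC0_mem_c0Sub (hδ : 0 < δ) {f : C₀(X, ℂ)} (hf : f ∈ c0Sub U) :
    softC0 δ hδ f ∈ c0Sub U :=
  c0Sub_mono (setOf_le_norm_subset hδ hf) (softC0_mem_c0Sub_setOf_le_norm hδ f)

theorem mul_mem_c0Sub_left {f : C₀(X, ℂ)} (hf : f ∈ c0Sub U) (g : C₀(X, ℂ)) :
    f * g ∈ c0Sub U := fun x hx => by
  rw [ZeroAtInftyContinuousMap.mul_apply, hf x hx, zero_mul]

theorem mul_mem_c0Sub_right {f : C₀(X, ℂ)} (hf : f ∈ c0Sub U) (g : C₀(X, ℂ)) :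
    g * f ∈ c0Sub U := mul_comm f g ▸ mul_mem_c0Sub_left hf g

theorem norm_add_le_max_of_mem_c0Sub {f g : C₀(X, ℂ)} (hf : f ∈ c0Sub U)
    (hg : g ∈ c0Sub Uᶜ) : ‖f + g‖ ≤ max ‖f‖ ‖g‖ := by
  refine c0_norm_le_of _ (by positivity) fun x => ?_
  rw [ZeroAtInftyContinuousMap.add_apply]
  by_cases hx : x ∈ U
  · rw [hg x (not_not_intro hx), add_zero]
    exact le_max_of_le_left (c0_norm_le f x)
  · rw [hf x hx, zero_add]
    exact le_max_of_le_right (c0_norm_le g x)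

/-- Evaluation at a point, as a functional on `C₀(X)`. -/
def evalC0 (x : X) : StrongDual ℂ C₀(X, ℂ) :=
  LinearMap.mkContinuous (⟨⟨fun f => f x, fun _ _ => rfl⟩, fun _ _ => rfl⟩ : C₀(X, ℂ) →ₗ[ℂ] ℂ) 1
    fun f => by simpa using c0_norm_le f x

theorem evalC0_apply (x : X) (f : C₀(X, ℂ)) : evalC0 x f = f x := rfl

theorem c0_sum_apply {ι : Type*} (s : Finset ι) (f : ι → C₀(X, ℂ)) (x : X) :
    (∑ i ∈ s, f i) x = ∑ i ∈ s, f i x := map_sum (evalC0 x) f s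

variable [T2Space X] [LocallyCompactSpace X]

theorem exists_c0_decomposition {ι : Type*} [Fintype ι] {K : Set X} {U : ι → Set X}
    (hK : IsCompact K) (hU : ∀ i, IsOpen (U i)) (hKU : K ⊆ ⋃ i, U i) {g : C₀(X, ℂ)}
    (hg : g ∈ c0Sub K) :
    ∃ f : ι → C₀(X, ℂ), (∀ i, f i ∈ c0Sub (U i)) ∧ (∀ i, ‖f i‖ ≤ ‖g‖) ∧ ∑ i, f i = g := by
  let e := Fintype.equivFin ι
  obtain ⟨χ, hsupp, hsum, hIcc, hcomp⟩ := exists_continuous_sum_one_of_isOpen_isCompact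
    (s := fun k => U (e.symm k)) (fun k => hU _) hK (by rwa [e.symm.surjective.iUnion_comp U])
  let χ' (i : ι) : C₀(X, ℂ) := (⟨⟨fun x => (χ (e i) x : ℂ), by fun_prop⟩,
    (show HasCompactSupport (χ (e i)) from hcomp (e i)).comp_left Complex.ofReal_zero⟩ :
      C_c(X, ℂ))
  have hχ' (i x) : χ' i x = χ (e i) x := rfl
  refine ⟨fun i => χ' i * g, fun i => mul_mem_c0Sub_left (fun x hx => ?_) g, fun i => ?_, ?_⟩
  · rw [hχ', Complex.ofReal_eq_zero]
    exact image_eq_zero_of_notMem_tsupport fun h => hx (by simpa using hsupp (e i) h)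
  · refine (norm_mul_le _ _).trans (mul_le_of_le_one_left (norm_nonneg _) ?_)
    refine c0_norm_le_of _ zero_le_one fun x => ?_
    rw [hχ', Complex.norm_real, Real.norm_of_nonneg (hIcc _ _).1]
    exact (hIcc _ _).2
  · ext x
    rw [← Finset.sum_mul, ZeroAtInftyContinuousMap.mul_apply, c0_sum_apply]
    by_cases hx : x ∈ K
    · have hsum_x : ∑ k, χ k x = 1 := by simpa using hsum hx
      simp only [hχ', e.sum_comp (fun k => (χ k x : ℂ)), ← Complex.ofReal_sum, hsum_x,
        Complex.ofReal_one, one_mul]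
    · rw [hg x hx, mul_zero]

end C0

section Bump

variable {X : Type u} [TopologicalSpace X] {U K : Set X}

/-- The functions with values in `[0, 1]` that are supported in `U` and equal to `1` on `K`. -/
def bumpSet (U K : Set X) : Set C₀(X, ℂ) :=
  {h | h ∈ c0Sub U ∧ (∀ x ∈ K, h x = 1) ∧ ∀ x, ∃ r ∈ Set.Icc (0 : ℝ) 1, h x = r}

theorem norm_le_one_of_mem_bumpSet {h : C₀(X, ℂ)} (hh : h ∈ bumpSet U K) : ‖h‖ ≤ 1 :=
  c0_norm_le_of _ zero_le_one fun x => by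
    obtain ⟨r, hr, hx⟩ := hh.2.2 x
    rw [hx, Complex.norm_real, Real.norm_of_nonneg hr.1]
    exact hr.2

theorem norm_sub_mul_le_of_mem_bumpSet {h : C₀(X, ℂ)} (hh : h ∈ bumpSet U K)
    (f : C₀(X, ℂ)) : ‖f - h * f‖ ≤ ‖f‖ := c0_norm_le_of _ (norm_nonneg f) fun x => by
  obtain ⟨r, hr, hx⟩ := hh.2.2 x
  have : (f - h * f) x = ((1 - r : ℝ) : ℂ) * f x := by
    rw [ZeroAtInftyContinuousMap.sub_apply, ZeroAtInftyContinuousMap.mul_apply, hx]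
    push_cast; ring
  rw [this, norm_mul, Complex.norm_real, Real.norm_of_nonneg (by linarith [hr.2])]
  exact (mul_le_of_le_one_left (norm_nonneg _) (by linarith [hr.1])).trans (c0_norm_le f x)

theorem sub_mul_mem_c0Sub_diff {h : C₀(X, ℂ)} (hh : h ∈ bumpSet U K) {f : C₀(X, ℂ)}
    (hf : f ∈ c0Sub U) : f - h * f ∈ c0Sub (U \ K) := fun x hx => by
  rw [ZeroAtInftyContinuousMap.sub_apply, ZeroAtInftyContinuousMap.mul_apply]
  by_cases hxU : x ∈ U
  · rw [hh.2.1 x (by simpa [hxU] using hx), one_mul, sub_self]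
  · rw [hf x hxU, mul_zero, sub_zero]

/-- The filter along which bump functions supported in `U` increase to the indicator of `U`. -/
def bumpFilter (U : Set X) : Filter C₀(X, ℂ) :=
  ⨅ K : {K : Set X // K ⊆ U ∧ IsCompact K}, 𝓟 (bumpSet U K)

theorem bumpSet_mem_bumpFilter (hKU : K ⊆ U) (hK : IsCompact K) :
    bumpSet U K ∈ bumpFilter U :=
  mem_iInf_of_mem ⟨K, hKU, hK⟩ (mem_principal_self _)

variable [T2Space X] [LocallyCompactSpace X]

theorem bumpSet_nonempty (hK : IsCompact K) (hU : IsOpen U) (hKU : K ⊆ U) :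
    (bumpSet U K).Nonempty := by
  obtain ⟨f, hfK, hf, hfU, hf01⟩ :=
    exists_continuousMap_one_of_isCompact_subset_isOpen hK hU hKU
  have hf0 {x} (hx : x ∉ U) : f x = 0 := image_eq_zero_of_notMem_tsupport fun h => hx (hfU h)
  let h : C₀(X, ℂ) := (⟨⟨fun x => (f x : ℂ), by fun_prop⟩,
    (show HasCompactSupport f from hf).comp_left Complex.ofReal_zero⟩ : C_c(X, ℂ))
  have hh (x) : h x = f x := rfl
  exact ⟨h, fun x hx => by simp [hh, hf0 hx], fun x hx => by simp [hh, hfK hx],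
    fun x => ⟨f x, hf01 x, rfl⟩⟩

theorem bumpFilter_neBot (hU : IsOpen U) : (bumpFilter U).NeBot := by
  have : Nonempty {K : Set X // K ⊆ U ∧ IsCompact K} :=
    ⟨⟨∅, Set.empty_subset _, isCompact_empty⟩⟩
  refine iInf_neBot_of_directed' (fun K L => ?_) fun K =>
    principal_neBot_iff.2 (bumpSet_nonempty K.2.2 hU K.2.1)
  refine ⟨⟨K ∪ L, Set.union_subset K.2.1 L.2.1, K.2.2.union L.2.2⟩, ?_, ?_⟩
  · exact principal_mono.2 fun h hh => ⟨hh.1, fun x hx => hh.2.1 x (Or.inl hx), hh.2.2⟩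
  · exact principal_mono.2 fun h hh => ⟨hh.1, fun x hx => hh.2.1 x (Or.inr hx), hh.2.2⟩

end Bump

/-! ### Functionals on normed spaces -/

section Functional

variable {E : Type*} [NormedAddCommGroup E] [NormedSpace ℂ E]

theorem norm_apply_add_norm_apply_le (φ : StrongDual ℂ E) {f g : E} {r : ℝ}
    (h : ∀ c d : ℂ, ‖c‖ = 1 → ‖d‖ = 1 → ‖c • f + d • g‖ ≤ r) :
    ‖φ f‖ + ‖φ g‖ ≤ ‖φ‖ * r := by
  obtain ⟨c, hc, hcf⟩ := RCLike.exists_norm_eq_mul_self (φ f)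
  obtain ⟨d, hd, hdg⟩ := RCLike.exists_norm_eq_mul_self (φ g)
  have heq : φ (c • f + d • g) = ((‖φ f‖ + ‖φ g‖ : ℝ) : ℂ) := by
    rw [map_add, map_smul, map_smul, smul_eq_mul, smul_eq_mul, Complex.ofReal_add]
    exact congr_arg₂ _ hcf.symm hdg.symm
  calc ‖φ f‖ + ‖φ g‖ = ‖φ (c • f + d • g)‖ := by
        rw [heq, Complex.norm_real, Real.norm_of_nonneg (by positivity)]
    _ ≤ ‖φ‖ * ‖c • f + d • g‖ := φ.le_opNorm _
    _ ≤ ‖φ‖ * r := by gcongr; exact h c d hc hd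

-- If `g` almost attains the norm of `φ` on `p`, then `φ` is small on every `f` that is disjoint
-- from `g` in the sense of the inner hypothesis.
theorem exists_almost_norming (p : Submodule ℂ E) (φ : StrongDual ℂ E) {δ : ℝ} (hδ : 0 < δ) :
    ∃ g ∈ p, ‖g‖ ≤ 1 ∧ ∃ ε > 0, ∀ g' ∈ p, ‖g - g'‖ ≤ ε → ∀ f ∈ p,
      (∀ c d : ℂ, ‖c‖ = 1 → ‖d‖ = 1 → ‖c • (‖f‖ : ℂ) • g' + d • f‖ ≤ ‖f‖) →
      ‖φ f‖ ≤ δ * ‖f‖ := by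
  let ψ : StrongDual ℂ p := φ ∘L p.subtypeL
  obtain ⟨g, hg, hψg⟩ := ψ.exists_lt_apply_of_lt_opNorm (r := ‖ψ‖ - δ / 2) (by linarith)
  obtain ⟨ε, hε, hψε⟩ := exists_pos_mul_lt (half_pos hδ) ‖ψ‖
  refine ⟨g, g.2, hg.le, ε, hε, fun g' hg' hgg' f hf hfg' => ?_⟩
  have hdiff : ‖ψ g - ψ ⟨g', hg'⟩‖ ≤ ‖ψ‖ * ε := by
    rw [← map_sub]
    exact (ψ.le_opNorm _).trans (by gcongr; exact hgg')
  have hnorm : ‖ψ ((‖f‖ : ℂ) • ⟨g', hg'⟩)‖ + ‖ψ ⟨f, hf⟩‖ ≤ ‖ψ‖ * ‖f‖ :=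
    norm_apply_add_norm_apply_le ψ hfg'
  rw [map_smul, norm_smul, Complex.norm_real, norm_norm] at hnorm
  have hψg' : ‖ψ‖ - δ ≤ ‖ψ ⟨g', hg'⟩‖ := by linarith [norm_sub_norm_le (ψ g) (ψ ⟨g', hg'⟩)]
  calc ‖φ f‖ = ‖ψ ⟨f, hf⟩‖ := rfl
    _ ≤ δ * ‖f‖ := by nlinarith [norm_nonneg f]

theorem exists_extension_of_linearIsometry {F : Type*} [NormedAddCommGroup F] [NormedSpace ℂ F]
    (j : E →ₗᵢ[ℂ] F) (φ : StrongDual ℂ E) :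
    ∃ ψ : StrongDual ℂ F, (∀ x, ψ (j x) = φ x) ∧ ‖ψ‖ ≤ ‖φ‖ := by
  obtain ⟨ψ, hψ, hnorm⟩ := exists_extension_norm_eq (LinearMap.range j.toLinearMap)
    (φ ∘L (j.equivRange.symm.toContinuousLinearEquiv : _ →L[ℂ] E))
  refine ⟨ψ, fun x => by simpa using hψ (j.equivRange x), ?_⟩
  rw [hnorm]
  refine ContinuousLinearMap.opNorm_le_bound _ (norm_nonneg _) fun y => ?_
  have hy := φ.le_opNorm (j.equivRange.symm y)
  rwa [j.equivRange.symm.norm_map] at hy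

theorem norm_apply_le_of_mem_bipolar (p : Submodule ℂ E) (e : StrongDual ℂ (StrongDual ℂ E))
    (he : ∀ φ : StrongDual ℂ E, (∀ f ∈ p, φ f = 0) → e φ = 0) (φ : StrongDual ℂ E) {δ : ℝ}
    (hδ : 0 ≤ δ) (hφ : ∀ f ∈ p, ‖φ f‖ ≤ δ * ‖f‖) : ‖e φ‖ ≤ ‖e‖ * δ := by
  obtain ⟨ψ, hψ, hnorm⟩ := exists_extension_norm_eq p (φ ∘L p.subtypeL)
  have heq : e φ = e ψ := by
    rw [← sub_eq_zero, ← map_sub]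
    refine he _ fun f hf => ?_
    rw [sub_apply, sub_eq_zero]
    exact (hψ ⟨f, hf⟩).symm
  have hψδ : ‖ψ‖ ≤ δ :=
    hnorm ▸ ContinuousLinearMap.opNorm_le_bound _ hδ fun f => hφ f f.2
  rw [heq]
  exact (e.le_opNorm ψ).trans (by gcongr)

theorem exists_weakStar_limit {E : Type u} [NormedAddCommGroup E] [NormedSpace ℂ E]
    (l : Ultrafilter E) {r : ℝ} (hl : ∀ᶠ h in (l : Filter E), ‖h‖ ≤ r) :
    ∃ e : Bidual E, ∀ φ : StrongDual ℂ E, Tendsto φ l (𝓝 (e φ)) := by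
  let j (h : E) : WeakDual ℂ (StrongDual ℂ E) :=
    StrongDual.toWeakDual (NormedSpace.inclusionInDoubleDual ℂ E h)
  have hball : ∀ᶠ h in (l : Filter E), j h ∈ WeakDual.toStrongDual ⁻¹'
      Metric.closedBall (0 : Bidual E) r := by
    filter_upwards [hl] with h hh
    exact (mem_closedBall_zero_iff (E := Bidual E)).2
      ((NormedSpace.double_dual_bound ℂ E h).trans hh)
  obtain ⟨w, -, hw⟩ := (WeakDual.isCompact_closedBall (𝕜 := ℂ)
    (0 : Bidual E) r).ultrafilter_le_nhds (l.map j) (le_principal_iff.2 hball)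
  exact ⟨WeakDual.toStrongDual w, fun φ =>
    ((WeakDual.eval_continuous φ).tendsto w).comp (show Tendsto j l (𝓝 w) from hw)⟩

end Functional

/-! ### Functionals on `C₀(X)` -/

section C0Functional

variable {X : Type u} [TopologicalSpace X] {U : Set X} {δ : ℝ}

theorem exists_compact_norm_apply_le_c0Sub_diff (φ : StrongDual ℂ C₀(X, ℂ)) (U : Set X)
    (hδ : 0 < δ) : ∃ K ⊆ U, IsCompact K ∧ ∀ f ∈ c0Sub (U \ K), ‖φ f‖ ≤ δ * ‖f‖ := by
  obtain ⟨g, hgU, hg, ε, hε, hgε⟩ := exists_almost_norming (c0Sub U) φ hδ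
  set K := {x | ε ≤ ‖g x‖}
  have hsoft : softC0 ε hε g ∈ c0Sub K := softC0_mem_c0Sub_setOf_le_norm hε g
  refine ⟨K, setOf_le_norm_subset hε hgU, c0_compact g hε, fun f hf =>
    hgε _ (softC0_mem_c0Sub hε hgU) (norm_sub_softC0_le hε g) f
      (c0Sub_mono Set.sdiff_subset hf) fun c d hc hd => ?_⟩
  refine (norm_add_le_max_of_mem_c0Sub
    (Submodule.smul_mem _ c (Submodule.smul_mem _ (‖f‖ : ℂ) hsoft))
    (Submodule.smul_mem _ d (c0Sub_mono (fun x hx => hx.2) hf))).trans (max_le ?_ ?_)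
  · rw [norm_smul, hc, one_mul, norm_smul, Complex.norm_real, norm_norm]
    exact mul_le_of_le_one_right (norm_nonneg f) ((norm_softC0_le hε g).trans hg)
  · rw [norm_smul, hd, one_mul]

/-- The functional `a ↦ φ (a * c)`. -/
def dualMul (c : C₀(X, ℂ)) (φ : StrongDual ℂ C₀(X, ℂ)) : StrongDual ℂ C₀(X, ℂ) :=
  φ ∘L (ContinuousLinearMap.mul ℂ C₀(X, ℂ)).flip c

theorem dualMul_apply (c : C₀(X, ℂ)) (φ : StrongDual ℂ C₀(X, ℂ)) (a : C₀(X, ℂ)) :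
    dualMul c φ a = φ (a * c) := rfl

/-- `e` is the unit of the bidual of `C₀(U)`: it lies in the bipolar of `C₀(U)` and acts on
`C₀(U)` as a left unit for the Arens product. -/
structure IsBidualUnit (U : Set X) (e : Bidual C₀(X, ℂ)) : Prop where
  bipolar : ∀ φ : StrongDual ℂ C₀(X, ℂ), (∀ f ∈ c0Sub U, φ f = 0) → e φ = 0
  unit : ∀ φ : StrongDual ℂ C₀(X, ℂ), ∀ b ∈ c0Sub U, e (dualMul b φ) = φ b

theorem IsBidualUnit.norm_apply_dualMul_sub_le {K : Set X} {e : Bidual C₀(X, ℂ)}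
    (he : IsBidualUnit U e) (φ : StrongDual ℂ C₀(X, ℂ)) (hδ : 0 ≤ δ)
    (hK : ∀ f ∈ c0Sub (U \ K), ‖φ f‖ ≤ δ * ‖f‖) {h : C₀(X, ℂ)}
    (hh : h ∈ bumpSet U K) (c : C₀(X, ℂ)) :
    ‖e (dualMul c φ) - φ (h * c)‖ ≤ δ * (‖e‖ * ‖c‖) := by
  rw [← he.unit φ _ (mul_mem_c0Sub_left hh.1 c), ← map_sub]
  refine (norm_apply_le_of_mem_bipolar (c0Sub U) e he.bipolar _ (δ := δ * ‖c‖) (by positivity)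
    fun f hf => ?_).trans_eq (by ring)
  have hfc : f * c ∈ c0Sub U := mul_mem_c0Sub_left hf c
  calc ‖(dualMul c φ - dualMul (h * c) φ) f‖ = ‖φ (f * c - h * (f * c))‖ := by
        rw [sub_apply, dualMul_apply, dualMul_apply, ← map_sub, mul_left_comm]
    _ ≤ δ * ‖f * c - h * (f * c)‖ := hK _ (sub_mul_mem_c0Sub_diff hh hfc)
    _ ≤ δ * (‖f‖ * ‖c‖) := by
        gcongr
        exact (norm_sub_mul_le_of_mem_bumpSet hh _).trans (norm_mul_le _ _)
    _ = δ * ‖c‖ * ‖f‖ := by ring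

theorem eventually_norm_apply_sub_mul_le (φ : StrongDual ℂ C₀(X, ℂ)) (hδ : 0 < δ) :
    ∀ᶠ h in bumpFilter U, ∀ f ∈ c0Sub U, ‖φ (f - h * f)‖ ≤ δ * ‖f‖ := by
  obtain ⟨K, hKU, hK, hKφ⟩ := exists_compact_norm_apply_le_c0Sub_diff φ U hδ
  filter_upwards [bumpSet_mem_bumpFilter hKU hK] with h hh f hf
  exact (hKφ _ (sub_mul_mem_c0Sub_diff hh hf)).trans
    (by gcongr; exact norm_sub_mul_le_of_mem_bumpSet hh f)

variable [T2Space X] [LocallyCompactSpace X]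

theorem norm_apply_le_of_norm_apply_le_of_iUnion {ι : Type*} [Fintype ι]
    (φ : StrongDual ℂ C₀(X, ℂ)) {T : ι → Set X} (hT : ∀ i, IsOpen (T i)) (hδ : 0 ≤ δ)
    (hφ : ∀ i, ∀ f ∈ c0Sub (T i), ‖φ f‖ ≤ δ * ‖f‖) {F : C₀(X, ℂ)} {M : ℝ} (hM : 0 ≤ M)
    (hF : ∀ x ∉ ⋃ i, T i, ‖F x‖ ≤ M) :
    ‖φ F‖ ≤ M * ‖φ‖ + δ * (Fintype.card ι * ‖F‖) := by
  refine le_of_forall_pos_le_add fun ε hε => ?_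
  obtain ⟨η, hη, hφη⟩ := exists_pos_mul_lt hε ‖φ‖
  have hMη : 0 < M + η := by positivity
  have hKT : {x | M + η ≤ ‖F x‖} ⊆ ⋃ i, T i := fun x hx => by
    by_contra hxT
    exact (hF x hxT).not_gt ((lt_add_of_pos_right M hη).trans_le hx)
  obtain ⟨f, hfT, hfnorm, hfsum⟩ := exists_c0_decomposition (c0_compact F hMη) hT hKT
    (softC0_mem_c0Sub_setOf_le_norm hMη F)
  have hsoft : ‖φ (softC0 (M + η) hMη F)‖ ≤ δ * (Fintype.card ι * ‖F‖) := by
    rw [← hfsum, map_sum]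
    calc ‖∑ i, φ (f i)‖ ≤ ∑ _i : ι, δ * ‖F‖ := norm_sum_le_of_le _ fun i _ =>
          (hφ i _ (hfT i)).trans (by gcongr; exact (hfnorm i).trans (norm_softC0_le hMη F))
      _ = δ * (Fintype.card ι * ‖F‖) := by
          rw [Finset.sum_const, Finset.card_univ, nsmul_eq_mul, mul_left_comm]
  have hdiff : ‖φ F - φ (softC0 (M + η) hMη F)‖ ≤ ‖φ‖ * (M + η) := by
    rw [← map_sub]
    exact (φ.le_opNorm _).trans (by gcongr; exact norm_sub_softC0_le hMη F)
  linarith [norm_sub_norm_le (φ F) (φ (softC0 (M + η) hMη F))]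

-- Off the small sets `U i \ K i` the indicator of `U i` agrees with a bump function, so there the
-- combination of units agrees with an element of `C₀(X)`.
open Classical in
theorem norm_sum_bidualUnit_sub_le {ι : Type*} [Fintype ι] {U : ι → Set X}
    (hU : ∀ i, IsOpen (U i)) {e : ι → Bidual C₀(X, ℂ)}
    (he : ∀ i, IsBidualUnit (U i) (e i)) (c : ι → C₀(X, ℂ)) (a : C₀(X, ℂ)) {M : ℝ} (hM : 0 ≤ M)
    (hle : ∀ x, ‖∑ i, (if x ∈ U i then c i x else 0) - a x‖ ≤ M) (φ : StrongDual ℂ C₀(X, ℂ)) :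
    ‖∑ i, e i (dualMul (c i) φ) - φ a‖ ≤ M * ‖φ‖ := by
  set B : ℝ := ∑ i, ‖c i‖ + ‖a‖
  refine le_of_forall_pos_le_add fun ε hε => ?_
  obtain ⟨δ, hδ, hδε⟩ := exists_pos_mul_lt hε (Fintype.card ι * B + ∑ i, ‖e i‖ * ‖c i‖)
  choose K hKU hK hKφ using fun i => exists_compact_norm_apply_le_c0Sub_diff φ (U i) hδ
  choose h hh using fun i => bumpSet_nonempty (hK i) (hU i) (hKU i)
  set F : C₀(X, ℂ) := ∑ i, h i * c i - a with hF
  have hFle : ∀ x ∉ ⋃ i, U i \ K i, ‖F x‖ ≤ M := fun x hx => by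
    convert hle x using 2
    rw [hF, ZeroAtInftyContinuousMap.sub_apply, c0_sum_apply]
    congr! 2 with i
    rw [ZeroAtInftyContinuousMap.mul_apply]
    split_ifs with hxi
    · have hxK : x ∈ K i := by_contra fun hxK => hx (Set.mem_iUnion.2 ⟨i, hxi, hxK⟩)
      rw [(hh i).2.1 x hxK, one_mul]
    · rw [(hh i).1 x hxi, zero_mul]
  have hFnorm : ‖F‖ ≤ B := by
    refine (norm_sub_le _ _).trans (add_le_add_left ?_ _)
    exact norm_sum_le_of_le _ fun i _ => (norm_mul_le _ _).trans
      (mul_le_of_le_one_left (norm_nonneg _) (norm_le_one_of_mem_bumpSet (hh i)))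
  have hφF : ‖φ F‖ ≤ M * ‖φ‖ + δ * (Fintype.card ι * B) :=
    (norm_apply_le_of_norm_apply_le_of_iUnion φ (fun i => (hU i).sdiff (hK i).isClosed) hδ.le
      hKφ hM hFle).trans (by gcongr)
  have hunits : ‖∑ i, (e i (dualMul (c i) φ) - φ (h i * c i))‖ ≤ δ * ∑ i, ‖e i‖ * ‖c i‖ := by
    rw [Finset.mul_sum]
    exact norm_sum_le_of_le _ fun i _ =>
      (he i).norm_apply_dualMul_sub_le φ hδ.le (hKφ i) (hh i) (c i)
  calc ‖∑ i, e i (dualMul (c i) φ) - φ a‖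
      = ‖∑ i, (e i (dualMul (c i) φ) - φ (h i * c i)) + φ F‖ := by
        rw [hF, map_sub, map_sum, Finset.sum_sub_distrib, sub_add_sub_cancel]
    _ ≤ δ * ∑ i, ‖e i‖ * ‖c i‖ + (M * ‖φ‖ + δ * (Fintype.card ι * B)) :=
        norm_add_le_of_le hunits hφF
    _ ≤ M * ‖φ‖ + ε := by linarith

open Classical in
theorem IsBidualUnit.apply_dualMul_evalC0 (hU : IsOpen U)
    {e : Bidual C₀(X, ℂ)} (he : IsBidualUnit U e) (c : C₀(X, ℂ)) (x : X) :
    e (dualMul c (evalC0 x)) = if x ∈ U then c x else 0 := by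
  split_ifs with hx
  · obtain ⟨h, hhU, hhx, -⟩ :=
      bumpSet_nonempty isCompact_singleton hU (Set.singleton_subset_iff.2 hx)
    have heq : dualMul c (evalC0 x) = dualMul (h * c) (evalC0 x) := by
      ext f
      simp only [dualMul_apply, evalC0_apply, ZeroAtInftyContinuousMap.mul_apply, hhx x rfl,
        one_mul]
    rw [heq, he.unit _ _ (mul_mem_c0Sub_left hhU c), evalC0_apply,
      ZeroAtInftyContinuousMap.mul_apply, hhx x rfl, one_mul]
  · refine he.bipolar _ fun f hf => ?_
    rw [dualMul_apply, evalC0_apply, ZeroAtInftyContinuousMap.mul_apply, hf x hx, zero_mul]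

end C0Functional

/-! ### The Fell bundle of an action -/

open InverseMonoid

theorem FellBundle.isUnitOf_of_tendsto {S : Type u} [InverseMonoid S] (A : FellBundle S)
    {J : Submodule ℂ (A.Fib 1)} {ι : Type*} {l : Filter ι} [l.NeBot] {h : ι → A.Fib 1}
    {e : Bidual (A.Fib 1)}
    (he : ∀ φ : StrongDual ℂ (A.Fib 1), Tendsto (fun i => φ (h i)) l (𝓝 (e φ)))
    (hJ : ∀ᶠ i in l, h i ∈ J)
    (hl : ∀ φ : StrongDual ℂ (A.Fib 1), ∀ δ > 0, ∀ᶠ i in l, ∀ b ∈ J,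
      ‖φ (b - A.lmul 1 (h i) b)‖ ≤ δ * ‖b‖)
    (hr : ∀ φ : StrongDual ℂ (A.Fib 1), ∀ b ∈ J,
      Tendsto (fun i => φ (A.lmul 1 b (h i))) l (𝓝 (φ b))) :
    A.IsUnitOf J e := by
  refine ⟨fun φ hφ => ?_, fun x hx => ⟨?_, ?_⟩⟩
  · refine tendsto_nhds_unique (he φ) (tendsto_const_nhds.congr' ?_)
    filter_upwards [hJ] with i hi
    exact (hφ _ hi).symm
  · ext φ
    rw [arens_apply]
    refine tendsto_nhds_unique (he _) (tendsto_iff_norm_sub_tendsto_zero.2 ?_)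
    refine NormedAddGroup.tendsto_nhds_zero.2 fun ε hε => ?_
    obtain ⟨δ, hδ, hδε⟩ := exists_pos_mul_lt hε ‖x‖
    filter_upwards [hl φ δ hδ] with i hi
    rw [norm_norm, norm_sub_rev]
    change ‖x φ - x (φ ∘L A.lmul 1 (h i))‖ < ε
    rw [← map_sub]
    refine (norm_apply_le_of_mem_bipolar J x hx _ hδ.le fun b hb => ?_).trans_lt hδε
    have hb' := hi b hb
    rwa [map_sub] at hb'
  · ext φ
    rw [arens_apply, ← sub_eq_zero, ← map_sub]
    refine hx _ fun b hb => ?_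
    rw [sub_apply, sub_eq_zero]
    exact tendsto_nhds_unique (he (φ ∘L A.lmul 1 b)) (hr φ b hb)

namespace PartialAction

variable {S : Type u} [InverseMonoid S] {X : Type u} [TopologicalSpace X] (α : PartialAction S X)

theorem target_one : (α.act 1).target = Set.univ := α.act_one.target_eq

theorem act_one_symm_apply (x : X) : (α.act 1).symm x = x :=
  α.act_one.symm_eqOn_target (by rw [target_one]; trivial)

theorem target_mul_inv (s : S) : (α.act (s * s⁻¹)).target = (α.act s).target := by
  ext x
  rw [mem_target_mul, target_inv]
  exact ⟨fun h => h.1, fun h => ⟨h, (α.act s).map_target h⟩⟩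

/-- The union of the domains of the `v` with `v ≤ s` and `v ≤ 1`; it is the open subset of `X`
whose functions form the ideal `I_{s,1}`. -/
def unitSet (s : S) : Set X :=
  ⋃ v : {v : S // NatLE v s ∧ NatLE v 1}, (α.act (v.1⁻¹ * v.1)).target

theorem isOpen_unitSet (s : S) : IsOpen (α.unitSet s) :=
  isOpen_iUnion fun _ => (α.act _).open_target

variable [T2Space X]

/-- The inclusion of a fibre into `C₀(X)`. -/
def toC0 (s : S) : α.fellBundle.Fib s →ₗᵢ[ℂ] C₀(X, ℂ) where
  toFun f := f.1
  map_add' _ _ := rfl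
  map_smul' _ _ := rfl
  norm_map' _ := rfl

theorem toC0_mem {s : S} (f : α.fellBundle.Fib s) : α.toC0 s f ∈ c0Sub (α.act s).target := f.2

/-- A function in `C₀(ran αₛ)` as an element of the fibre over `s`. -/
def ofC0 {s : S} (f : C₀(X, ℂ)) (hf : f ∈ c0Sub (α.act s).target) : α.fellBundle.Fib s := ⟨f, hf⟩

/-- The inclusion of `C₀(X)`, as the fibre over `1`. -/
def ofC0One : C₀(X, ℂ) →ₗᵢ[ℂ] α.fellBundle.Fib 1 where
  toFun f := α.ofC0 f fun x hx => (hx (by rw [target_one]; trivial)).elim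
  map_add' _ _ := rfl
  map_smul' _ _ := rfl
  norm_map' _ := rfl

theorem toC0_ofC0One (f : C₀(X, ℂ)) : α.toC0 1 (α.ofC0One f) = f := rfl

theorem toC0_lmul (s : S) (a : α.fellBundle.Fib 1) (b : α.fellBundle.Fib s) :
    α.toC0 s (α.fellBundle.lmul s a b) = α.toC0 1 a * α.toC0 s b := by
  ext x
  change a.1 x * b.1 ((α.act 1).symm x) = a.1 x * b.1 x
  rw [act_one_symm_apply]

theorem lmul_one_comm (a b : α.fellBundle.Fib 1) :
    α.fellBundle.lmul 1 a b = α.fellBundle.lmul 1 b a :=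
  (α.toC0 1).injective (by rw [toC0_lmul, toC0_lmul, mul_comm])

theorem ofC0One_mul_toC0 (h : C₀(X, ℂ)) (b : α.fellBundle.Fib 1) :
    α.ofC0One (h * α.toC0 1 b) = α.fellBundle.lmul 1 (α.ofC0One h) b :=
  (α.toC0 1).injective (by rw [toC0_lmul, toC0_ofC0One, toC0_ofC0One])

theorem toC0_rmul_apply (s : S) (a : α.fellBundle.Fib s) (b : α.fellBundle.Fib 1) (x : X) :
    α.toC0 s (α.fellBundle.rmul s a b) x = α.toC0 s a x * α.toC0 1 b ((α.act s).symm x) := rfl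

theorem toC0_starOne_apply (a : α.fellBundle.Fib 1) (x : X) :
    α.toC0 1 (α.fellBundle.starOne a) x = conj (α.toC0 1 a x) := by
  have hx : x ∈ (α.act 1).source := by rw [α.act_one.source_eq]; trivial
  refine (fibStar_of_mem α 1 a hx).trans ?_
  rw [α.act_one.eqOn hx]
  rfl

theorem mem_idemIdeal_iff {e : S} (he : e * e = e) (f : α.fellBundle.Fib 1) :
    f ∈ α.fellBundle.idemIdeal e he ↔ α.toC0 1 f ∈ c0Sub (α.act e).target :=
  ⟨by rintro ⟨g, rfl⟩; exact g.2, fun h => ⟨α.ofC0 _ h, rfl⟩⟩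

theorem toC0_mem_of_mem_idealOf {s : S} {f : α.fellBundle.Fib 1}
    (hf : f ∈ α.fellBundle.idealOf s 1) : α.toC0 1 f ∈ c0Sub (α.unitSet s) := by
  refine Submodule.mem_sInf.1 hf ((c0Sub (α.unitSet s)).comap (α.toC0 1).toLinearMap)
    ⟨(c0_isClosed_vanishing (α.unitSet s)).preimage (α.toC0 1).continuous,
      fun a b hb => ⟨?_, ?_⟩, fun v hvs hv1 b hb => ?_⟩
  · change α.toC0 1 _ ∈ c0Sub (α.unitSet s)
    rw [toC0_lmul]
    exact mul_mem_c0Sub_right hb _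
  · change α.toC0 1 _ ∈ c0Sub (α.unitSet s)
    rw [toC0_lmul]
    exact mul_mem_c0Sub_left hb _
  · rw [mem_idemIdeal_iff] at hb
    exact fun x hx => hb x fun hxv => hx (Set.mem_iUnion.2 ⟨⟨v, hvs, hv1⟩, hxv⟩)

/-- The restriction of functionals along the inclusion of a fibre into `C₀(X)`. -/
def dualRestrict (s : S) : StrongDual ℂ C₀(X, ℂ) →L[ℂ] StrongDual ℂ (α.fellBundle.Fib s) :=
  (ContinuousLinearMap.compL ℂ (α.fellBundle.Fib s) C₀(X, ℂ) ℂ).flip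
    (α.toC0 s).toContinuousLinearMap

theorem dualRestrict_apply (s : S) (φ : StrongDual ℂ C₀(X, ℂ)) (f : α.fellBundle.Fib s) :
    α.dualRestrict s φ f = φ (α.toC0 s f) := rfl

theorem arens_unitProj_toBidual (s w : S) (c : α.fellBundle.Fib s) (φ : StrongDual ℂ C₀(X, ℂ)) :
    arens (α.fellBundle.lmul s) (α.fellBundle.unitProj w) (toBidual c) (α.dualRestrict s φ) =
      (α.fellBundle.unitProj w ∘L α.dualRestrict 1) (dualMul (α.toC0 s c) φ) := by
  rw [arens_apply]
  refine congr_arg (α.fellBundle.unitProj w) (ContinuousLinearMap.ext fun a => ?_)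
  change φ (α.toC0 s (α.fellBundle.lmul s a c)) = φ (α.toC0 1 a * α.toC0 s c)
  rw [toC0_lmul]

theorem arens_toBidual_unitProj (w : S) (c : α.fellBundle.Fib 1) :
    arens (α.fellBundle.lmul 1) (toBidual c) (α.fellBundle.unitProj w) =
      arens (α.fellBundle.lmul 1) (α.fellBundle.unitProj w) (toBidual c) := by
  ext φ
  rw [arens_apply, arens_apply]
  refine congr_arg (α.fellBundle.unitProj w) (ContinuousLinearMap.ext fun a => ?_)
  exact congr_arg φ (α.lmul_one_comm c a)

variable [LocallyCompactSpace X]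

theorem mem_idealOf_of_toC0_mem {s : S} {f : α.fellBundle.Fib 1}
    (hf : α.toC0 1 f ∈ c0Sub (α.unitSet s)) : f ∈ α.fellBundle.idealOf s 1 := by
  refine Submodule.mem_sInf.2 fun J ⟨hJclosed, _, hJ⟩ => ?_
  have hsoft (δ : ℝ) (hδ : 0 < δ) : α.ofC0One (softC0 δ hδ (α.toC0 1 f)) ∈ J := by
    have hK := c0_compact (α.toC0 1 f) hδ
    obtain ⟨T, hT⟩ := hK.elim_finite_subcover _ (fun v => (α.act _).open_target)
      (setOf_le_norm_subset hδ hf)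
    obtain ⟨g, hg, -, hsum⟩ := exists_c0_decomposition (ι := T) hK
      (fun v => (α.act (v.1.1⁻¹ * v.1.1)).open_target)
      (by simpa only [Set.iUnion_subtype] using hT) (softC0_mem_c0Sub_setOf_le_norm hδ _)
    rw [← hsum, map_sum]
    exact J.sum_mem fun v _ => hJ v.1.1 v.1.2.1 v.1.2.2 ((α.mem_idemIdeal_iff _ _).2 (hg v))
  refine hJclosed.closure_subset (Metric.mem_closure_iff.2 fun ε hε =>
    ⟨_, hsoft (ε / 2) (half_pos hε), ?_⟩)
  rw [dist_eq_norm, ← (α.toC0 1).norm_map, map_sub, toC0_ofC0One]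
  exact (norm_sub_softC0_le _ _).trans_lt (half_lt_self hε)

theorem exists_isUnitOf (s : S) : ∃ e, α.fellBundle.IsUnitOf (α.fellBundle.idealOf s 1) e := by
  have := bumpFilter_neBot (α.isOpen_unitSet s)
  let l := Ultrafilter.of (bumpFilter (α.unitSet s))
  have hbump : ∀ᶠ h in (l : Filter C₀(X, ℂ)), h ∈ bumpSet (α.unitSet s) ∅ :=
    Ultrafilter.of_le _ (bumpSet_mem_bumpFilter (Set.empty_subset _) isCompact_empty)
  obtain ⟨e, he⟩ := exists_weakStar_limit (l.map α.ofC0One) (r := 1) (eventually_map.2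
    (hbump.mono fun h hh => (α.ofC0One.norm_map h).trans_le (norm_le_one_of_mem_bumpSet hh)))
  have hl (φ : StrongDual ℂ (α.fellBundle.Fib 1)) (δ : ℝ) (hδ : 0 < δ) : ∀ᶠ h in (l : Filter _),
      ∀ b ∈ α.fellBundle.idealOf s 1,
        ‖φ (b - α.fellBundle.lmul 1 (α.ofC0One h) b)‖ ≤ δ * ‖b‖ := by
    filter_upwards [Ultrafilter.of_le _ (eventually_norm_apply_sub_mul_le
      (φ ∘L α.ofC0One.toContinuousLinearMap) hδ)] with h hh b hb
    rw [← ofC0One_mul_toC0]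
    exact hh (α.toC0 1 b) (α.toC0_mem_of_mem_idealOf hb)
  refine ⟨e, α.fellBundle.isUnitOf_of_tendsto (l := (l : Filter _)) (h := fun h => α.ofC0One h)
    (fun φ => (he φ).comp tendsto_map)
    (hbump.mono fun h hh => α.mem_idealOf_of_toC0_mem hh.1) hl fun φ b hb => ?_⟩
  refine tendsto_iff_norm_sub_tendsto_zero.2 (NormedAddGroup.tendsto_nhds_zero.2 fun ε hε => ?_)
  obtain ⟨δ, hδ, hδε⟩ := exists_pos_mul_lt hε ‖b‖
  filter_upwards [hl φ δ hδ] with h hh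
  rw [norm_norm, norm_sub_rev, lmul_one_comm, ← map_sub]
  exact (hh b hb).trans_lt (by rwa [mul_comm])

theorem isUnitOf_unitProj (s : S) :
    α.fellBundle.IsUnitOf (α.fellBundle.idealOf s 1) (α.fellBundle.unitProj s) := by
  have h := α.exists_isUnitOf s
  rw [FellBundle.unitProj, dif_pos h]
  exact h.choose_spec

theorem isBidualUnit_unitProj (s : S) :
    IsBidualUnit (α.unitSet s) (α.fellBundle.unitProj s ∘L α.dualRestrict 1) where
  bipolar φ hφ := (α.isUnitOf_unitProj s).1 _ fun b hb => hφ _ (α.toC0_mem_of_mem_idealOf hb)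
  unit φ b hb := by
    have hmem : toBidual (α.ofC0One b) ∈
        α.fellBundle.bidualOf (α.fellBundle.idealOf s 1) := fun ψ hψ =>
      hψ _ (α.mem_idealOf_of_toC0_mem hb)
    have hunit := congr_arg (fun z => z (α.dualRestrict 1 φ))
      ((α.isUnitOf_unitProj s).2 _ hmem).1
    simp only [arens_unitProj_toBidual] at hunit
    exact hunit

open Classical in
theorem norm_sum_arens_sub_le_iff (s : S) {ι : Type*} (F : Finset ι) (w : ι → S)
    (c : ι → α.fellBundle.Fib s) (a : α.fellBundle.Fib s) {M : ℝ} (hM : 0 ≤ M) :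
    ‖∑ i ∈ F, arens (α.fellBundle.lmul s) (α.fellBundle.unitProj (w i)) (toBidual (c i)) -
        toBidual a‖ ≤ M ↔
      ∀ x, ‖∑ i ∈ F, (if x ∈ α.unitSet (w i) then α.toC0 s (c i) x else 0) -
        α.toC0 s a x‖ ≤ M := by
  simp only [← Finset.sum_coe_sort F]
  set Φ := ∑ i : F, arens (α.fellBundle.lmul s) (α.fellBundle.unitProj (w i)) (toBidual (c i)) -
    toBidual a with hΦ
  have heval (φ : StrongDual ℂ C₀(X, ℂ)) : Φ (α.dualRestrict s φ) =
      ∑ i : F, (α.fellBundle.unitProj (w i) ∘L α.dualRestrict 1) (dualMul (α.toC0 s (c i)) φ) -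
        φ (α.toC0 s a) := by
    rw [hΦ, sub_apply, sum_apply]
    simp only [arens_unitProj_toBidual]
    rfl
  constructor
  · intro hΦM x
    have hx := heval (evalC0 x)
    simp only [(α.isBidualUnit_unitProj _).apply_dualMul_evalC0 (α.isOpen_unitSet _),
      evalC0_apply] at hx
    rw [← hx]
    refine (Φ.le_of_opNorm_le hΦM _).trans (mul_le_of_le_one_right hM ?_)
    refine ContinuousLinearMap.opNorm_le_bound _ zero_le_one fun f => ?_
    rw [dualRestrict_apply, one_mul, ← (α.toC0 s).norm_map]
    exact c0_norm_le _ _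
  · refine fun h => Φ.opNorm_le_bound hM fun ψ => ?_
    obtain ⟨φ, hφ, hφnorm⟩ := exists_extension_of_linearIsometry (α.toC0 s) ψ
    obtain rfl : α.dualRestrict s φ = ψ := ContinuousLinearMap.ext hφ
    rw [heval φ]
    exact (norm_sum_bidualUnit_sub_le (fun i : F => α.isOpen_unitSet (w i))
      (fun i => α.isBidualUnit_unitProj (w i)) (fun i => α.toC0 s (c i)) (α.toC0 s a) hM h
        φ).trans (by gcongr)

end PartialAction

/-! ### Inverse semigroups of bisections -/

namespace TopGroupoid

variable {G : Type u} [TopologicalSpace G] [TopGroupoid G]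

theorem range_unit (x : UnitSpace G) : range x.1 = x := Subtype.ext (rng_of_unit x.2)

theorem source_unit (x : UnitSpace G) : source x.1 = x := Subtype.ext x.2

theorem inv_of_unit {x : G} (hx : src x = x) : inv x = x :=
  calc inv x = mul (inv x) (src (inv x)) := (mul_src _).symm
    _ = mul (inv x) x := by rw [src_inv, rng_of_unit hx]
    _ = x := (inv_mul x).trans hx

theorem inv_unit_mul {x h : G} (hx : src x = x) (hh : rng h = x) : mul (inv x) h = h := by
  rw [inv_of_unit hx, ← hh, rng_mul_self]

theorem range_inv_mul {k h : G} (hh : range h = range k) : range (mul (inv k) h) = source k := by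
  refine Subtype.ext ((rng_mul _ _ ?_).trans (rng_inv k))
  rw [src_inv, range_eq_iff.1 hh]

theorem eq_inv_of_src_mul {g h : G} (hgh : src g = rng h) (hunit : src (mul g h) = mul g h) :
    h = inv g := by
  have hrng : mul g h = rng g := (rng_of_unit hunit).symm.trans (rng_mul g h hgh)
  rw [← inv_mul_cancel_left hgh, hrng, ← src_inv, mul_src]

variable [IsEtale G]

theorem isOpenBisection_inter {u v : Set G} (hu : IsOpenBisection u) (hv : IsOpen v) :
    IsOpenBisection (u ∩ v) :=
  isOpenBisection_of (hu.isOpen.inter hv) (fun _ hg _ hh => hu.src_inj hg.1 hh.1)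
    fun _ hg _ hh => hu.rng_inj hg.1 hh.1

theorem src_eq_of_mem_idem {e : Bis G} (he : e * e = e) {g : G} (hg : g ∈ e.1) : src g = g := by
  obtain ⟨a, ha, b, hb, hab, rfl⟩ : g ∈ (e * e).1 := by rwa [he]
  have hb' : mul a b = b := e.2.src_inj hg hb (src_mul a b hab)
  have ha' : mul a b = a := e.2.rng_inj hg ha (rng_mul a b hab)
  obtain rfl : a = b := ha'.symm.trans hb'
  rw [ha', ← inv_mul a, ← congrArg (mul (inv a)) ha', inv_mul_cancel_left hab]

theorem idem_of_subset_one {v : Bis G} (h : v.1 ⊆ (1 : Bis G).1) : v * v = v := by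
  have hunit {g : G} (hg : g ∈ v.1) : src g = g := h hg
  refine Subtype.ext (Set.ext fun g => ⟨?_, fun hg => ?_⟩)
  · rintro ⟨a, ha, b, hb, hab, rfl⟩
    rwa [← hunit ha, hab, rng_mul_self]
  · refine ⟨g, hg, g, hg, ?_, ?_⟩
    · rw [hunit hg, rng_of_unit (hunit hg)]
    · exact (congrArg (mul g) (hunit hg).symm).trans (mul_src g)

theorem mem_mul_iff {u v : Bis G} {k h : G} (hk : k ∈ u.1) (hh : rng h = rng k) :
    h ∈ (u * v).1 ↔ mul (inv k) h ∈ v.1 := by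
  constructor
  · rintro ⟨a, ha, b, hb, hab, rfl⟩
    obtain rfl : a = k := u.2.rng_inj ha hk ((rng_mul a b hab).symm.trans hh)
    rwa [inv_mul_cancel_left hab]
  · refine fun hv => ⟨k, hk, _, hv, ?_, mul_inv_cancel_left hh.symm⟩
    rw [rng_mul _ _ (by rw [src_inv, hh]), rng_inv]

theorem unit_mem_mul_inv_iff {u v : Bis G} {x : UnitSpace G} :
    x.1 ∈ (u * v⁻¹).1 ↔ ∃ h, range h = x ∧ h ∈ u.1 ∧ h ∈ v.1 := by
  constructor
  · rintro ⟨g, hg, b, hb, hgb, hx⟩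
    obtain rfl : b = inv g := eq_inv_of_src_mul hgb (by rw [hx]; exact x.2)
    refine ⟨g, Subtype.ext ((mul_inv g).symm.trans hx), hg, ?_⟩
    rwa [mem_inv_iff, inv_inv_self] at hb
  · rintro ⟨h, rfl, hu, hv⟩
    exact ⟨h, hu, inv h, inv_mem_inv v hv, (rng_inv h).symm, mul_inv h⟩

theorem subset_of_natLE {u v : Bis G} (h : NatLE v u) : v.1 ⊆ u.1 := by
  obtain ⟨e, he, rfl⟩ := h
  rintro _ ⟨g, hg, h, hh, hgh, rfl⟩
  have hunit := src_eq_of_mem_idem he hh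
  rwa [← rng_of_unit hunit, ← hgh, mul_src]

theorem eq_mul_of_subset {u v : Bis G} (h : v.1 ⊆ u.1) : v = u * (v⁻¹ * v) := by
  refine Subtype.ext (Set.ext fun g => ⟨fun hg => ?_, ?_⟩)
  · exact ⟨g, h hg, src g, ⟨inv g, inv_mem_inv v hg, g, hg, src_inv g, inv_mul g⟩,
      (rng_src g).symm, mul_src g⟩
  · rintro ⟨a, ha, _, ⟨b, hb, c, hc, hbc, rfl⟩, habc, rfl⟩
    obtain rfl : inv b = c := v.2.rng_inj hb hc (by rw [rng_inv, hbc])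
    rw [mul_inv] at habc ⊢
    rw [rng_rng] at habc
    rw [← habc, mul_src, u.2.src_inj ha (h hb) (by rw [habc, src_inv])]
    exact hb

theorem natLE_of_subset {u v : Bis G} (h : v.1 ⊆ u.1) : NatLE v u :=
  ⟨v⁻¹ * v, idem_inv_mul v, eq_mul_of_subset h⟩

/-- `ι : M → Bis(G)` is a homomorphism with a wide image, and `α` is the canonical action of `M`
on the unit space. -/
structure IsWideHom {M : Type u} [InverseMonoid M] (ι : M → Bis G)
    (α : PartialAction M (UnitSpace G)) : Prop where
  map_one : ι 1 = 1
  map_mul : ∀ s t, ι (s * t) = ι s * ι t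
  map_inv : ∀ s, ι s⁻¹ = (ι s)⁻¹
  act_eq : ∀ s, α.act s = bisHomeo (ι s)
  cover : ∀ g : G, ∃ s, g ∈ (ι s).1
  unit_inter : ∀ s, ∀ x : UnitSpace G, x.1 ∈ (ι s).1 →
    ∃ v, NatLE v s ∧ NatLE v 1 ∧ x.1 ∈ (ι v).1

namespace IsWideHom

variable {M : Type u} [InverseMonoid M] {ι : M → Bis G} {α : PartialAction M (UnitSpace G)}
  (hι : IsWideHom ι α)

include hι

theorem map_subset {s t : M} (h : NatLE s t) : (ι s).1 ⊆ (ι t).1 := by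
  obtain ⟨e, he, rfl⟩ := h
  exact subset_of_natLE ⟨ι e, by rw [← hι.map_mul, he], hι.map_mul _ _⟩

theorem target_eq (s : M) : (α.act s).target = range '' (ι s).1 := by
  rw [hι.act_eq]; rfl

theorem target_inv_mul_eq (s : M) : (α.act (s⁻¹ * s)).target = source '' (ι s).1 := by
  have htarget := α.target_mul_inv s⁻¹
  rw [inv_inv_eq, α.target_inv, hι.act_eq s] at htarget
  exact htarget

theorem act_symm_range {s : M} {k : G} (hk : k ∈ (ι s).1) :
    (α.act s).symm (range k) = source k := by
  rw [hι.act_eq]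
  exact bisFun_inv_range (ι s) hk

theorem mem_unitSet_iff (s : M) (x : UnitSpace G) : x ∈ α.unitSet s ↔ x.1 ∈ (ι s).1 := by
  rw [PartialAction.unitSet, Set.mem_iUnion]
  constructor
  · rintro ⟨⟨v, hvs, hv1⟩, hx⟩
    obtain ⟨g, hg, rfl⟩ := (hι.target_inv_mul_eq v).subset hx
    have hunit : src g = g := by
      have hg1 := hι.map_subset hv1 hg
      rwa [hι.map_one] at hg1
    exact hι.map_subset hvs (hunit.symm ▸ hg : src g ∈ (ι v).1)
  · intro hx
    obtain ⟨v, hvs, hv1, hxv⟩ := hι.unit_inter s x hx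
    exact ⟨⟨v, hvs, hv1⟩, (hι.target_inv_mul_eq v).superset ⟨x.1, hxv, source_unit x⟩⟩

theorem range_mem_unitSet_iff {s : M} {k : G} (hk : k ∈ (ι s).1) (p t : M) :
    range k ∈ α.unitSet (p * (s * t)⁻¹) ↔
      ∃ h, range h = range k ∧ h ∈ (ι p).1 ∧ mul (inv k) h ∈ (ι t).1 := by
  rw [hι.mem_unitSet_iff, hι.map_mul, hι.map_inv, hι.map_mul, unit_mem_mul_inv_iff]
  exact exists_congr fun h => and_congr_right fun hh => and_congr_right fun _ =>
    mem_mul_iff hk (range_eq_iff.1 hh)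

end IsWideHom

end TopGroupoid

/-! ### Sections as functions on the groupoid -/

namespace TopGroupoid

variable {G : Type u} [TopologicalSpace G] [TopGroupoid G]

/-- The coefficient `∑_{r(h) = r(g)} conj (η h) η (g⁻¹ h)` of the left regular representation. -/
def coeff (η : G → ℂ) (g : G) : ℂ :=
  ∑ᶠ h : {h : G // range h = range g}, conj (η h) * η (mul (inv g) h)

/-- The squared norm `∑_{r(h) = x} |η h|²` of `η` on the fibre of the range map over `x`. -/
def sqNorm (η : G → ℂ) (x : UnitSpace G) : ℝ := ∑ᶠ h : {h : G // range h = x}, ‖η h‖ ^ 2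

/-- `η` is finitely supported on each fibre of the range map. -/
def FibrewiseFinite (η : G → ℂ) : Prop :=
  ∀ x : UnitSpace G, (Function.support fun h : {h : G // range h = x} => η h).Finite

theorem sqNorm_nonneg (η : G → ℂ) (x : UnitSpace G) : 0 ≤ sqNorm η x :=
  finsum_nonneg fun _ => by positivity

theorem FibrewiseFinite.ofReal_sqNorm {η : G → ℂ} (hη : FibrewiseFinite η) (x : UnitSpace G) :
    (sqNorm η x : ℂ) = coeff η x.1 := by
  have hmap : (sqNorm η x : ℂ) = ∑ᶠ h : {h : G // range h = x}, ((‖η h‖ ^ 2 : ℝ) : ℂ) :=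
    map_finsum Complex.ofRealHom ((hη x).subset fun h hh h0 => hh (by simp [h0]))
  rw [hmap, coeff, range_unit]
  refine finsum_congr fun h => ?_
  rw [inv_unit_mul x.2 (congrArg Subtype.val h.2), ← Complex.normSq_eq_norm_sq,
    Complex.normSq_eq_conj_mul_self]

/-- Left translation by `k⁻¹` between the fibres of the range map. -/
def translate (k : G) : {h : G // range h = range k} ≃ {h : G // range h = source k} where
  toFun h := ⟨mul (inv k) h.1, range_inv_mul h.2⟩
  invFun h := ⟨mul k h.1, Subtype.ext (rng_mul _ _ (congrArg Subtype.val h.2).symm)⟩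
  left_inv h := Subtype.ext (mul_inv_cancel_left (range_eq_iff.1 h.2).symm)
  right_inv h := Subtype.ext (inv_mul_cancel_left (congrArg Subtype.val h.2).symm)

theorem norm_finsum_conj_mul_le {A : Type*} {f g : A → ℂ} (hf : f.support.Finite)
    (hg : g.support.Finite) :
    ‖∑ᶠ a, conj (f a) * g a‖ ≤ (∑ᶠ a, ‖f a‖ ^ 2 + ∑ᶠ a, ‖g a‖ ^ 2) / 2 := by
  classical
  have hsub {N : Type} [AddCommMonoid N] {φ : A → N} (hφ : ∀ a, f a = 0 → g a = 0 → φ a = 0) :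
      φ.support ⊆ ↑(hf.toFinset ∪ hg.toFinset) := fun a ha => by
    by_contra hfg
    simp only [Finset.coe_union, Set.Finite.coe_toFinset, Set.mem_union, Function.mem_support,
      not_or, not_not] at hfg
    exact ha (hφ a hfg.1 hfg.2)
  rw [finsum_eq_sum_of_support_subset _ (hsub fun a h _ => by simp [h]),
    finsum_eq_sum_of_support_subset _ (hsub fun a h _ => by simp [h]),
    finsum_eq_sum_of_support_subset _ (hsub fun a _ h => by simp [h]),
    ← Finset.sum_add_distrib, Finset.sum_div]
  refine norm_sum_le_of_le _ fun a _ => ?_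
  rw [norm_mul, RCLike.norm_conj]
  linarith [two_mul_le_add_sq ‖f a‖ ‖g a‖]

theorem FibrewiseFinite.norm_coeff_le {η : G → ℂ} (hη : FibrewiseFinite η) (k : G) :
    ‖coeff η k‖ ≤ (sqNorm η (range k) + sqNorm η (source k)) / 2 := by
  rw [sqNorm, sqNorm, ← finsum_comp_equiv (translate k)]
  exact norm_finsum_conj_mul_le (hη (range k))
    ((hη (source k)).preimage (translate k).injective.injOn)

theorem sqNorm_mul_range (ψ : UnitSpace G → ℂ) (η : G → ℂ) (x : UnitSpace G) :
    sqNorm (fun g => ψ (range g) * η g) x = ‖ψ x‖ ^ 2 * sqNorm η x := by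
  rw [sqNorm, sqNorm, ← smul_eq_mul, smul_finsum]
  refine finsum_congr fun h => ?_
  rw [h.2, norm_mul, mul_pow, smul_eq_mul]

theorem coeff_mul_range (ψ : UnitSpace G → ℂ) (η : G → ℂ) (k : G) :
    coeff (fun g => ψ (range g) * η g) k = conj (ψ (range k)) * ψ (source k) * coeff η k := by
  rw [coeff, coeff, ← smul_eq_mul _ (∑ᶠ _, _), smul_finsum]
  refine finsum_congr fun h => ?_
  rw [range_inv_mul h.2, h.2, map_mul, smul_eq_mul]
  ring

open Classical in
/-- The function `f ∘ r` on `u ⊆ G`, extended by zero. -/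
def bisectionFun (u : Set G) : C₀(UnitSpace G, ℂ) →ₗ[ℂ] (G → ℂ) where
  toFun f g := if g ∈ u then f (range g) else 0
  map_add' f f' := by ext g; by_cases hg : g ∈ u <;> simp [hg]
  map_smul' c f := by ext g; by_cases hg : g ∈ u <;> simp [hg]

open Classical in
theorem bisectionFun_apply (u : Set G) (f : C₀(UnitSpace G, ℂ)) (g : G) :
    bisectionFun u f g = if g ∈ u then f (range g) else 0 := rfl

theorem finite_setOf_mem_bisection {u : Set G} (hu : IsOpenBisection u) (x : UnitSpace G) :
    {h : {h : G // range h = x} | h.1 ∈ u}.Finite :=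
  Set.Subsingleton.finite fun a ha b hb =>
    Subtype.ext (hu.rng_inj ha hb (range_eq_iff.1 (a.2.trans b.2.symm)))

theorem finsum_ite_of_subsingleton {A N : Type*} [AddCommMonoid N] {P : A → Prop}
    [DecidablePred P] [Decidable (∃ a, P a)] (hP : {a | P a}.Subsingleton) (c : N) :
    ∑ᶠ a, (if P a then c else 0) = if ∃ a, P a then c else 0 := by
  split_ifs with h
  · obtain ⟨a, ha⟩ := h
    exact (finsum_eq_single _ a fun b hb => if_neg fun hb' => hb (hP hb' ha)).trans (if_pos ha)
  · exact finsum_eq_zero_of_forall_eq_zero fun a => if_neg fun ha => h ⟨a, ha⟩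

variable [T2Space (UnitSpace G)] {M : Type u} [InverseMonoid M]

/-- The function `∑_p (ξ_p ∘ r) 1_{ι(p)}` on `G` that corresponds to `ξ ∈ Γ_c(M, A)`. -/
def sectionFun (ι : M → Bis G) (α : PartialAction M (UnitSpace G)) :
    (M →₀ α.fellBundle.Fib 1) →ₗ[ℂ] (G → ℂ) :=
  Finsupp.lsum ℂ fun p => bisectionFun (ι p).1 ∘ₗ (α.toC0 1).toLinearMap

section SectionFun

variable (ι : M → Bis G) {α : PartialAction M (UnitSpace G)}

theorem sectionFun_single (p : M) (f : α.fellBundle.Fib 1) :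
    sectionFun ι α (Finsupp.single p f) = bisectionFun (ι p).1 (α.toC0 1 f) :=
  Finsupp.lsum_single ..

theorem sectionFun_eq_sum {F : Finset M} {ξ : M →₀ α.fellBundle.Fib 1} (hF : ξ.support ⊆ F) :
    sectionFun ι α ξ = ∑ p ∈ F, bisectionFun (ι p).1 (α.toC0 1 (ξ p)) :=
  Finsupp.sum_of_support_subset _ hF _ fun _ _ => map_zero _

open Classical in
theorem sectionFun_apply {F : Finset M} {ξ : M →₀ α.fellBundle.Fib 1} (hF : ξ.support ⊆ F)
    (g : G) : sectionFun ι α ξ g =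
      ∑ p ∈ F, if g ∈ (ι p).1 then α.toC0 1 (ξ p) (range g) else 0 := by
  rw [sectionFun_eq_sum ι hF, Finset.sum_apply]
  rfl

theorem fibrewiseFinite_sectionFun (ξ : M →₀ α.fellBundle.Fib 1) :
    FibrewiseFinite (sectionFun ι α ξ) := fun x => by
  classical
  refine (ξ.support.finite_toSet.biUnion fun p _ =>
    finite_setOf_mem_bisection (ι p).2 x).subset fun h hh => ?_
  rw [Function.mem_support, sectionFun_apply ι subset_rfl] at hh
  obtain ⟨p, hp, hne⟩ := Finset.exists_ne_zero_of_sum_ne_zero hh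
  exact Set.mem_biUnion hp (by_contra fun hph => hne (if_neg hph))

end SectionFun

section Coeff

variable [IsEtale G] {ι : M → Bis G} {α : PartialAction M (UnitSpace G)} (hι : IsWideHom ι α)
include hι

open Classical in
theorem IsWideHom.coeff_sectionFun {F : Finset M} {ξ : M →₀ α.fellBundle.Fib 1}
    (hF : ξ.support ⊆ F) {s : M} {k : G} (hk : k ∈ (ι s).1) :
    coeff (sectionFun ι α ξ) k = ∑ i ∈ F ×ˢ F,
      if range k ∈ α.unitSet (i.1 * (s * i.2)⁻¹) then
        conj (α.toC0 1 (ξ i.1) (range k)) * α.toC0 1 (ξ i.2) (source k) else 0 := by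
  let P (i : M × M) (h : {h : G // range h = range k}) : Prop :=
    h.1 ∈ (ι i.1).1 ∧ mul (inv k) h ∈ (ι i.2).1
  let c (i : M × M) : ℂ := conj (α.toC0 1 (ξ i.1) (range k)) * α.toC0 1 (ξ i.2) (source k)
  have hP (i) : {h | P i h}.Subsingleton := fun a ha b hb => Subtype.ext <|
    (ι i.1).2.rng_inj ha.1 hb.1 (range_eq_iff.1 (a.2.trans b.2.symm))
  have hfin (i) : (Function.support fun h => if P i h then c i else 0).Finite :=
    (hP i).finite.subset fun h hh => by_contra fun hPh => hh (if_neg hPh)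
  have hexpand (h : {h : G // range h = range k}) :
      conj (sectionFun ι α ξ h) * sectionFun ι α ξ (mul (inv k) h) =
        ∑ i ∈ F ×ˢ F, if P i h then c i else 0 := by
    rw [sectionFun_apply ι hF, sectionFun_apply ι hF, map_sum, Finset.sum_mul_sum,
      ← Finset.sum_product']
    refine Finset.sum_congr rfl fun i _ => ?_
    rw [h.2, range_inv_mul h.2, apply_ite conj, map_zero, ite_zero_mul_ite_zero]
  rw [coeff, finsum_congr hexpand, finsum_sum_comm _ _ fun i _ => hfin i]
  refine Finset.sum_congr rfl fun i _ => (finsum_ite_of_subsingleton (hP i) _).trans ?_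
  simp only [hι.range_mem_unitSet_iff hk, Subtype.exists, exists_prop, P, c]

end Coeff

end TopGroupoid

/-- `Γ_c(S, A)` as a subspace of the finitely supported functions. -/
def FellBundle.sectionSubmodule {S : Type u} [InverseMonoid S] (A : FellBundle S) :
    Submodule ℂ (S →₀ A.Fib 1) :=
  ⨅ p, (A.idemIdeal (p * p⁻¹) (idem_mul_inv p)).comap (Finsupp.lapply p)

theorem FellBundle.mem_sectionSubmodule_iff {S : Type u} [InverseMonoid S] {A : FellBundle S}
    {ξ : S →₀ A.Fib 1} : ξ ∈ A.sectionSubmodule ↔ ξ ∈ A.sections := by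
  simp only [sectionSubmodule, Submodule.mem_iInf, Submodule.mem_comap, Finsupp.lapply_apply,
    sections, Set.mem_ofPred_eq]

namespace TopGroupoid

section Norms

variable {G : Type u} [TopologicalSpace G] [TopGroupoid G] [IsEtale G] [T2Space (UnitSpace G)]
variable {M : Type u} [InverseMonoid M] {ι : M → Bis G} {α : PartialAction M (UnitSpace G)}
  (hι : IsWideHom ι α)

include hι

theorem IsWideHom.mem_sections_iff {ξ : M →₀ α.fellBundle.Fib 1} :
    ξ ∈ α.fellBundle.sections ↔ ∀ p, α.toC0 1 (ξ p) ∈ c0Sub (range '' (ι p).1) :=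
  forall_congr' fun p => by rw [α.mem_idemIdeal_iff, α.target_mul_inv, hι.target_eq]

open Classical in
theorem IsWideHom.sum_ite_toC0_eq_coeff_mul {s : M} {k : G} (hk : k ∈ (ι s).1)
    (ξ : M →₀ α.fellBundle.Fib 1) (a : α.fellBundle.Fib s) :
    ∑ i ∈ ξ.support ×ˢ ξ.support, (if range k ∈ α.unitSet (i.1 * (s * i.2)⁻¹) then
      α.toC0 s (α.fellBundle.rmul s (α.fellBundle.lmul s (α.fellBundle.starOne (ξ i.1)) a)
        (ξ i.2)) (range k) else 0) =
      coeff (sectionFun ι α ξ) k * α.toC0 s a (range k) := by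
  rw [hι.coeff_sectionFun subset_rfl hk, Finset.sum_mul]
  refine Finset.sum_congr rfl fun i _ => ?_
  rw [ite_mul, zero_mul, α.toC0_rmul_apply, α.toC0_lmul, ZeroAtInftyContinuousMap.mul_apply,
    α.toC0_starOne_apply, hι.act_symm_range hk]
  congr 1
  ring

open Classical in
theorem IsWideHom.sum_ite_toC0_eq_sqNorm (ξ : M →₀ α.fellBundle.Fib 1) (x : UnitSpace G) :
    ∑ i ∈ ξ.support ×ˢ ξ.support, (if x ∈ α.unitSet (i.1 * i.2⁻¹) then
      α.toC0 1 (α.fellBundle.lmul 1 (α.fellBundle.starOne (ξ i.1)) (ξ i.2)) x else 0) =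
      (sqNorm (sectionFun ι α ξ) x : ℂ) := by
  have hx : x.1 ∈ (ι 1).1 := by rw [hι.map_one]; exact x.2
  rw [(fibrewiseFinite_sectionFun ι ξ).ofReal_sqNorm, hι.coeff_sectionFun subset_rfl hx]
  refine Finset.sum_congr rfl fun i _ => ?_
  rw [one_mul, range_unit, source_unit, α.toC0_lmul, ZeroAtInftyContinuousMap.mul_apply,
    α.toC0_starOne_apply]

variable [LocallyCompactSpace (UnitSpace G)]

theorem IsWideHom.norm_approx_sub_le_iff (ξ : M →₀ α.fellBundle.Fib 1) (s : M)
    (a : α.fellBundle.Fib s) {ε : ℝ} (hε : 0 ≤ ε) :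
    ‖∑ p ∈ ξ.support, ∑ t ∈ ξ.support,
      arens (α.fellBundle.lmul s) (α.fellBundle.unitProj (p * (s * t)⁻¹))
        (toBidual (α.fellBundle.rmul s (α.fellBundle.lmul s (α.fellBundle.starOne (ξ p)) a)
          (ξ t))) - toBidual a‖ ≤ ε ↔
      ∀ k ∈ (ι s).1, ‖(coeff (sectionFun ι α ξ) k - 1) * α.toC0 s a (range k)‖ ≤ ε := by
  classical
  rw [← Finset.sum_product', α.norm_sum_arens_sub_le_iff s (ξ.support ×ˢ ξ.support)
    (fun i => i.1 * (s * i.2)⁻¹) (fun i => α.fellBundle.rmul s (α.fellBundle.lmul s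
      (α.fellBundle.starOne (ξ i.1)) a) (ξ i.2)) a hε]
  constructor
  · intro h k hk
    rw [sub_one_mul, ← hι.sum_ite_toC0_eq_coeff_mul hk]
    exact h (range k)
  · intro h x
    by_cases hx : x ∈ (α.act s).target
    · rw [hι.target_eq] at hx
      obtain ⟨k, hk, rfl⟩ := hx
      rw [hι.sum_ite_toC0_eq_coeff_mul hk, ← sub_one_mul]
      exact h k hk
    · have hzero (c : α.fellBundle.Fib s) : α.toC0 s c x = 0 := α.toC0_mem c x hx
      simpa only [hzero, ite_self, Finset.sum_const_zero, sub_zero, norm_zero] using hε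

theorem IsWideHom.norm_square_le_iff (ξ : M →₀ α.fellBundle.Fib 1) {C : ℝ} (hC : 0 ≤ C) :
    ‖∑ p ∈ ξ.support, ∑ t ∈ ξ.support,
      arens (α.fellBundle.lmul 1) (toBidual (α.fellBundle.lmul 1 (α.fellBundle.starOne (ξ p))
        (ξ t))) (α.fellBundle.unitProj (p * t⁻¹))‖ ≤ C ↔
      ∀ x, sqNorm (sectionFun ι α ξ) x ≤ C := by
  classical
  have h := α.norm_sum_arens_sub_le_iff 1 (ξ.support ×ˢ ξ.support) (fun i => i.1 * i.2⁻¹)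
    (fun i => α.fellBundle.lmul 1 (α.fellBundle.starOne (ξ i.1)) (ξ i.2)) 0 hC
  have hzero (y : Bidual (α.fellBundle.Fib 1)) : y - toBidual 0 = y :=
    (congrArg (y - ·) (map_zero _)).trans (sub_zero y)
  rw [hzero] at h
  simp only [hι.sum_ite_toC0_eq_sqNorm, map_zero, ZeroAtInftyContinuousMap.zero_apply, sub_zero,
    Complex.norm_real, Real.norm_of_nonneg (sqNorm_nonneg _ _)] at h
  simp only [α.arens_toBidual_unitProj, ← Finset.sum_product']
  exact h

end Norms

section Decomposition

variable {G : Type u} [TopologicalSpace G] [TopGroupoid G]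

theorem exists_bisectionFun_eq [T2Space (UnitSpace G)] {u : Set G} (hu : IsOpenBisection u)
    {f : G → ℂ} (hf : ContinuousOn f u) {K : Set G} (hKu : K ⊆ u) (hK : IsCompact K)
    (hf0 : ∀ g ∉ K, f g = 0) :
    ∃ φ ∈ c0Sub (range '' K), bisectionFun u φ = f := by
  classical
  have hKc : IsCompact (range '' K) := hK.image continuous_range
  let e : UnitSpace G → ℂ := Function.extend (fun g : u => range g.1) (fun g : u => f g) 0
  have he (g : u) : e (range g.1) = f g := hu.range_openEmbedding.injective.extend_apply _ _ g
  have he0 {x} (hx : x ∉ range '' K) : e x = 0 := by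
    by_cases h : ∃ g : u, range g.1 = x
    · obtain ⟨g, rfl⟩ := h
      rw [he, hf0 _ fun hg => hx ⟨g, hg, rfl⟩]
    · exact Function.extend_apply' _ _ _ h
  have hcont : Continuous e := continuous_iff_continuousAt.2 fun x => by
    by_cases hx : x ∈ range '' K
    · obtain ⟨g, hg, rfl⟩ := hx
      refine (hu.range_openEmbedding.continuousAt_iff (x := ⟨g, hKu hg⟩)).1 ?_
      rw [show e ∘ (fun g : u => range g.1) = u.domRestrict f from funext he]
      exact (continuousOn_iff_continuous_domRestrict.1 hf).continuousAt
    · refine continuousAt_const.congr (f := fun _ => (0 : ℂ)) ?_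
      filter_upwards [hKc.isClosed.isOpen_compl.mem_nhds hx] with y hy using (he0 hy).symm
  refine ⟨⟨⟨e, hcont⟩, (HasCompactSupport.intro hKc fun x => he0).is_zero_at_infty⟩,
    fun x => he0, funext fun g => ?_⟩
  by_cases hg : g ∈ u
  · exact (if_pos hg).trans (he ⟨g, hg⟩)
  · exact (if_neg hg).trans (hf0 g fun hgK => hg (hKu hgK)).symm

theorem bisectionFun_congr {u v : Set G} (hu : IsOpenBisection u) (hv : IsOpenBisection v)
    {ψ : C₀(UnitSpace G, ℂ)} (hψ : ψ ∈ c0Sub (range '' (u ∩ v))) :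
    bisectionFun u ψ = bisectionFun v ψ := by
  have hvanish {w : Set G} (hw : IsOpenBisection w) (huvw : u ∩ v ⊆ w) {g : G} (hg : g ∈ w)
      (hguv : g ∉ u ∩ v) : ψ (range g) = 0 := hψ _ <| by
    rintro ⟨h, hh, hhg⟩
    exact hguv (hw.rng_inj (huvw hh) hg (range_eq_iff.1 hhg) ▸ hh)
  funext g
  rw [bisectionFun_apply, bisectionFun_apply]
  by_cases hgu : g ∈ u <;> by_cases hgv : g ∈ v <;> simp only [hgu, hgv, if_true, if_false]
  · exact hvanish hu Set.inter_subset_left hgu fun h => hgv h.2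
  · exact (hvanish hv Set.inter_subset_right hgv fun h => hgu h.1).symm

variable [IsEtale G] [T2Space (UnitSpace G)]
variable {M : Type u} [InverseMonoid M] {ι : M → Bis G} {α : PartialAction M (UnitSpace G)}

theorem IsWideHom.single_mem_sectionSubmodule (hι : IsWideHom ι α) {p : M}
    {f : C₀(UnitSpace G, ℂ)} (hf : f ∈ c0Sub (range '' (ι p).1)) :
    Finsupp.single p (α.ofC0One f) ∈ α.fellBundle.sectionSubmodule := by
  rw [FellBundle.mem_sectionSubmodule_iff, hι.mem_sections_iff]
  intro q
  rcases eq_or_ne q p with rfl | hqp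
  · rwa [Finsupp.single_eq_same]
  · rw [Finsupp.single_eq_of_ne hqp, map_zero]
    exact Submodule.zero_mem _

theorem IsWideHom.compactlySupported_le_map [LocallyCompactSpace (UnitSpace G)]
    (hι : IsWideHom ι α) :
    CompactlySupported G ≤ α.fellBundle.sectionSubmodule.map (sectionFun ι α) := by
  refine Submodule.span_le.2 ?_
  rintro f ⟨u, hu, hfu, K, hKu, hK, hf0⟩
  obtain ⟨φ, hφ, rfl⟩ := exists_bisectionFun_eq hu hfu hKu hK hf0
  have hopen (p : M) : IsOpen (u ∩ (ι p).1) := hu.isOpen.inter (ι p).2.isOpen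
  obtain ⟨T, hT⟩ := hK.elim_finite_subcover _ hopen fun g hg =>
    let ⟨p, hp⟩ := hι.cover g
    Set.mem_iUnion.2 ⟨p, hKu hg, hp⟩
  have hcover : range '' K ⊆ ⋃ p : T, range '' (u ∩ (ι p).1) := by
    rw [← Set.image_iUnion, Set.iUnion_subtype]
    exact Set.image_mono hT
  obtain ⟨ψ, hψ, -, hsum⟩ := exists_c0_decomposition (hK.image continuous_range)
    (fun p : T => isOpenMap_range _ (hopen p)) hcover hφ
  rw [← hsum, map_sum]
  refine Submodule.sum_mem _ fun p _ => ⟨_, hι.single_mem_sectionSubmodule (p := p.1) <|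
    c0Sub_mono (Set.image_mono Set.inter_subset_right) (hψ p), ?_⟩
  rw [sectionFun_single, bisectionFun_congr hu (ι p).2 (hψ p)]
  rfl

end Decomposition

end TopGroupoid

/-! ### Amenability and the approximation property -/

theorem tendsto_bidual_iff {E : Type u} [NormedAddCommGroup E] [NormedSpace ℂ E] {I : Type*}
    {l : Filter I} {f : I → Bidual E} {y : Bidual E} :
    Tendsto f l (𝓝 y) ↔ ∀ ε > 0, ∀ᶠ i in l, ‖f i - y‖ < ε := by
  have hdist (a b : Bidual E) : dist a b = ‖a - b‖ := dist_eq_norm a b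
  simpa only [hdist] using Metric.tendsto_nhds (α := Bidual E) (u := f) (f := l) (a := y)

namespace PartialAction

variable {S : Type u} [InverseMonoid S] {X : Type u} [TopologicalSpace X] [T2Space X]
  (α : PartialAction S X)

/-- The section whose values are the soft thresholds of those of `ξ`. -/
def truncate {τ : ℝ} (hτ : 0 < τ) (ξ : S →₀ α.fellBundle.Fib 1) : S →₀ α.fellBundle.Fib 1 :=
  ξ.mapRange (fun f => α.ofC0One (softC0 τ hτ (α.toC0 1 f))) <| (α.toC0 1).injective <|
    ZeroAtInftyContinuousMap.ext fun _ => softThreshold_of_norm_le hτ (by simpa using hτ.le)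

theorem support_truncate_subset {τ : ℝ} (hτ : 0 < τ) (ξ : S →₀ α.fellBundle.Fib 1) :
    (α.truncate hτ ξ).support ⊆ ξ.support :=
  Finsupp.support_mapRange

end PartialAction

namespace TopGroupoid

section CompactSupport

variable {G : Type u} [TopologicalSpace G] [TopGroupoid G]

theorem isCompact_bisection_inter_preimage {u : Set G} (hu : IsOpenBisection u)
    {Q : Set (UnitSpace G)} (hQ : IsCompact Q) (hQu : Q ⊆ range '' u) :
    IsCompact (u ∩ range ⁻¹' Q) := by
  have hcompact := (hu.range_openEmbedding.isInducing.isCompact_preimage_iff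
    (by rintro x hx; obtain ⟨g, hg, rfl⟩ := hQu hx; exact ⟨⟨g, hg⟩, rfl⟩)).2 hQ
  rw [← Subtype.image_preimage_coe]
  exact hcompact.image continuous_subtype_val

theorem bisectionFun_mem_compactlySupported {u : Set G} (hu : IsOpenBisection u)
    {Q : Set (UnitSpace G)} (hQ : IsCompact Q) (hQu : Q ⊆ range '' u) {f : C₀(UnitSpace G, ℂ)}
    (hf : f ∈ c0Sub Q) : bisectionFun u f ∈ CompactlySupported G := by
  refine Submodule.subset_span ⟨u, hu, ?_, u ∩ range ⁻¹' Q, Set.inter_subset_left,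
    isCompact_bisection_inter_preimage hu hQ hQu, fun g hg => ?_⟩
  · exact ((map_continuous f).comp continuous_range).continuousOn.congr fun g hg => if_pos hg
  · by_cases hgu : g ∈ u
    · exact (if_pos hgu).trans (hf _ fun hgQ => hg ⟨hgu, hgQ⟩)
    · exact if_neg hgu

theorem mul_range_mem_compactlySupported {ψ : UnitSpace G → ℂ} (hψ : Continuous ψ) {η : G → ℂ}
    (hη : η ∈ CompactlySupported G) : (fun g => ψ (range g) * η g) ∈ CompactlySupported G := by
  suffices CompactlySupported G ≤
      (CompactlySupported G).comap (LinearMap.mulLeft ℂ fun g => ψ (range g)) from this hη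
  refine Submodule.span_le.2 ?_
  rintro f ⟨u, hu, hfu, K, hKu, hK, hf0⟩
  refine Submodule.subset_span ⟨u, hu, (hψ.comp continuous_range).continuousOn.mul hfu, K, hKu,
    hK, fun g hg => ?_⟩
  exact (congrArg (ψ (range g) * ·) (hf0 g hg)).trans (mul_zero _)

theorem exists_normalized_cutoff {η : G → ℂ} (hη : η ∈ CompactlySupported G)
    (hfin : FibrewiseFinite η) {φ : C(UnitSpace G, ℝ)} (hφ : ∀ x, φ x ∈ Set.Icc (0 : ℝ) 1)
    {K : Set G} (hφK : ∀ g ∈ K, φ (range g) = 1 ∧ φ (source g) = 1) {δ : ℝ} (hδ : 0 ≤ δ)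
    (hK : ∀ g ∈ K, ‖coeff η g - 1‖ ≤ δ) (hunit : ∀ x, φ x ≠ 0 → ‖coeff η x.1 - 1‖ ≤ δ) :
    ∃ η' ∈ CompactlySupported G, (∀ x, sqNorm η' x ≤ 1) ∧ ∀ g ∈ K, ‖coeff η' g - 1‖ ≤ 2 * δ := by
  set c : ℝ := (Real.sqrt (1 + δ))⁻¹
  have hc : c ^ 2 * (1 + δ) = 1 := by
    rw [inv_pow, Real.sq_sqrt (by positivity), inv_mul_cancel₀ (by positivity)]
  refine ⟨_, mul_range_mem_compactlySupported (ψ := fun x => ((c * φ x : ℝ) : ℂ))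
    (by fun_prop) hη, fun x => ?_, fun g hg => ?_⟩
  · rw [sqNorm_mul_range (fun x => ((c * φ x : ℝ) : ℂ)), Complex.norm_real, Real.norm_eq_abs,
      sq_abs]
    by_cases hx : φ x = 0
    · simp [hx]
    have hsq : sqNorm η x ≤ 1 + δ := by
      have h := hunit x hx
      rw [← hfin.ofReal_sqNorm, ← Complex.ofReal_one, ← Complex.ofReal_sub, Complex.norm_real] at h
      linarith [(abs_le.1 h).2]
    calc (c * φ x) ^ 2 * sqNorm η x = φ x ^ 2 * (c ^ 2 * sqNorm η x) := by ring
      _ ≤ 1 * (c ^ 2 * (1 + δ)) := mul_le_mul (pow_le_one₀ (hφ x).1 (hφ x).2) (by gcongr)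
        (mul_nonneg (sq_nonneg c) (sqNorm_nonneg η x)) zero_le_one
      _ = 1 := by rw [one_mul, hc]
  · have hcoeff : coeff (fun g => ((c * φ (range g) : ℝ) : ℂ) * η g) g - 1 =
        ((c ^ 2 : ℝ) : ℂ) * ((coeff η g - 1) - (δ : ℂ)) := by
      have hc' : (c : ℂ) ^ 2 * (1 + δ) = 1 := by exact_mod_cast hc
      rw [coeff_mul_range (fun x => ((c * φ x : ℝ) : ℂ))]
      simp only [(hφK g hg).1, (hφK g hg).2, mul_one, Complex.conj_ofReal]
      push_cast
      linear_combination hc'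
    rw [hcoeff, norm_mul, Complex.norm_real, Real.norm_of_nonneg (sq_nonneg c)]
    calc c ^ 2 * ‖(coeff η g - 1) - (δ : ℂ)‖ ≤ 1 * (δ + δ) :=
          mul_le_mul (by nlinarith [sq_nonneg c])
            (norm_sub_le_of_le (hK g hg) (by rw [Complex.norm_real, Real.norm_of_nonneg hδ]))
            (norm_nonneg _) zero_le_one
      _ = 2 * δ := by ring

theorem isTopologicallyAmenable_of_forall_isCompact
    (h : ∀ K : Set G, IsCompact K → ∀ ε > 0, ∃ η ∈ CompactlySupported G,
      (∀ x, sqNorm η x ≤ 1) ∧ ∀ g ∈ K, ‖coeff η g - 1‖ ≤ ε) : IsTopologicallyAmenable G := by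
  let I := {K : Set G // IsCompact K} × ℕ
  have : IsDirectedOrder I := ⟨fun i j =>
    ⟨⟨⟨i.1.1 ∪ j.1.1, i.1.2.union j.1.2⟩, max i.2 j.2⟩,
      ⟨Set.subset_union_left, le_max_left _ _⟩, ⟨Set.subset_union_right, le_max_right _ _⟩⟩⟩
  choose η hηc hηle hη using fun i : I =>
    h i.1.1 i.1.2 (1 / ((i.2 : ℝ) + 1)) Nat.one_div_pos_of_nat
  refine ⟨I, inferInstance, inferInstance, ⟨⟨⟨∅, isCompact_empty⟩, 0⟩⟩, η, hηc,
    fun i x => Real.sqrt_le_one.2 (hηle i x), fun K hK => ?_⟩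
  refine Metric.tendstoUniformlyOn_iff.2 fun ε hε => ?_
  obtain ⟨n, hn⟩ := exists_nat_one_div_lt hε
  filter_upwards [eventually_ge_atTop (⟨⟨K, hK⟩, n⟩ : I)] with i hi g hg
  rw [dist_comm, dist_eq_norm]
  exact (hη i g (hi.1 hg)).trans_lt ((Nat.one_div_le_one_div hi.2).trans_lt hn)

end CompactSupport

section Equivalence

variable {G : Type u} [TopologicalSpace G] [TopGroupoid G] [IsEtale G] [T2Space (UnitSpace G)]
variable {M : Type u} [InverseMonoid M] {ι : M → Bis G} {α : PartialAction M (UnitSpace G)}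

theorem IsWideHom.sectionFun_truncate_mem_compactlySupported (hι : IsWideHom ι α)
    {ξ : M →₀ α.fellBundle.Fib 1} (hξ : ξ ∈ α.fellBundle.sections) {τ : ℝ} (hτ : 0 < τ) :
    sectionFun ι α (α.truncate hτ ξ) ∈ CompactlySupported G := by
  rw [sectionFun_eq_sum ι subset_rfl]
  exact Submodule.sum_mem _ fun p _ => bisectionFun_mem_compactlySupported (ι p).2
    (c0_compact _ hτ) (setOf_le_norm_subset hτ (hι.mem_sections_iff.1 hξ p))
    (softC0_mem_c0Sub_setOf_le_norm hτ _)

theorem norm_conj_mul_sub_le {a b a' b' : ℂ} {B τ : ℝ} (ha : ‖a‖ ≤ B) (hb' : ‖b'‖ ≤ B)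
    (haa' : ‖a - a'‖ ≤ τ) (hbb' : ‖b - b'‖ ≤ τ) :
    ‖conj a' * b' - conj a * b‖ ≤ 2 * B * τ := by
  have hsplit : conj a' * b' - conj a * b = conj (a' - a) * b' + conj a * (b' - b) := by
    rw [map_sub]; ring
  rw [norm_sub_rev] at haa' hbb'
  calc ‖conj a' * b' - conj a * b‖ ≤ ‖a' - a‖ * ‖b'‖ + ‖a‖ * ‖b' - b‖ := by
        rw [hsplit]
        exact (norm_add_le _ _).trans_eq (by simp only [norm_mul, RCLike.norm_conj])
    _ ≤ τ * B + B * τ := by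
        gcongr
        exacts [(norm_nonneg _).trans haa', (norm_nonneg _).trans ha]
    _ = 2 * B * τ := by ring

theorem IsWideHom.exists_norm_coeff_truncate_sub_le (hι : IsWideHom ι α)
    (ξ : M →₀ α.fellBundle.Fib 1) {δ : ℝ} (hδ : 0 < δ) :
    ∃ (τ : ℝ) (hτ : 0 < τ), ∀ g,
      ‖coeff (sectionFun ι α (α.truncate hτ ξ)) g - coeff (sectionFun ι α ξ) g‖ ≤ δ := by
  classical
  set F := ξ.support
  set B : ℝ := ∑ p ∈ F, ‖ξ p‖
  have hB : ∀ p ∈ F, ‖α.toC0 1 (ξ p)‖ ≤ B := fun p hp => by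
    rw [(α.toC0 1).norm_map]
    exact Finset.single_le_sum (f := fun p => ‖ξ p‖) (fun _ _ => norm_nonneg _) hp
  obtain ⟨τ, hτ, hτδ⟩ := exists_pos_mul_lt hδ ((F ×ˢ F).card * (2 * B))
  refine ⟨τ, hτ, fun g => ?_⟩
  obtain ⟨s, hs⟩ := hι.cover g
  rw [hι.coeff_sectionFun (α.support_truncate_subset hτ ξ) hs, hι.coeff_sectionFun subset_rfl hs,
    ← Finset.sum_sub_distrib]
  refine (norm_sum_le_of_le (F ×ˢ F) (n := fun _ => 2 * B * τ) fun i hi => ?_).trans ?_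
  · obtain ⟨hi₁, hi₂⟩ := Finset.mem_product.1 hi
    split_ifs
    · exact norm_conj_mul_sub_le ((c0_norm_le _ _).trans (hB _ hi₁))
        ((c0_norm_le _ _).trans ((norm_softC0_le hτ _).trans (hB _ hi₂)))
        (norm_sub_softThreshold_le hτ _) (norm_sub_softThreshold_le hτ _)
    · rw [sub_zero, norm_zero]
      have : 0 ≤ B := (norm_nonneg _).trans (hB _ hi₁)
      positivity
  · rw [Finset.sum_const, nsmul_eq_mul, ← _root_.mul_assoc]
    exact hτδ.le

variable [LocallyCompactSpace G]

instance : LocallyCompactSpace (UnitSpace G) :=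
  (isOpenBisection_units (G := G)).isOpen.locallyCompactSpace

theorem norm_mul_le_of_le_norm {z w : ℂ} {ε B : ℝ} (hε : 0 ≤ ε) (hw : ‖w‖ ≤ B) (hz : ‖z‖ ≤ 2)
    (h : ε / 2 ≤ ‖w‖ → ‖z‖ ≤ ε / (B + 1)) : ‖z * w‖ ≤ ε := by
  have hB : 0 ≤ B := (norm_nonneg w).trans hw
  rw [norm_mul]
  rcases le_total (ε / 2) ‖w‖ with hεw | hεw
  · calc ‖z‖ * ‖w‖ ≤ ε / (B + 1) * (B + 1) :=
          mul_le_mul (h hεw) (by linarith) (norm_nonneg w) (by positivity)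
      _ = ε := div_mul_cancel₀ ε (by positivity)
  · calc ‖z‖ * ‖w‖ ≤ 2 * (ε / 2) := mul_le_mul hz hεw (norm_nonneg w) zero_le_two
      _ = ε := by ring

theorem IsWideHom.hasApproximationProperty_of_amenable (hι : IsWideHom ι α)
    (hG : IsTopologicallyAmenable G) : α.HasApproximationProperty := by
  obtain ⟨I, _, _, _, η, hηc, hηle, hη⟩ := hG
  choose ξ hξ hξη using fun i => hι.compactlySupported_le_map (hηc i)
  obtain rfl : (fun i => sectionFun ι α (ξ i)) = η := funext hξη
  have hsq (i) (x) : sqNorm (sectionFun ι α (ξ i)) x ≤ 1 := Real.sqrt_le_one.1 (hηle i x)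
  refine ⟨I, inferInstance, inferInstance, inferInstance, ξ,
    fun i => FellBundle.mem_sectionSubmodule_iff.1 (hξ i),
    ⟨1, fun i => (hι.norm_square_le_iff _ zero_le_one).2 (hsq i)⟩, fun s a => ?_⟩
  refine tendsto_bidual_iff.2 fun ε hε => ?_
  set f := α.toC0 s a
  have hf : {x | ε / 2 / 2 ≤ ‖f x‖} ⊆ range '' (ι s).1 :=
    setOf_le_norm_subset (by positivity) (by rw [← hι.target_eq]; exact α.toC0_mem a)
  have hK := isCompact_bisection_inter_preimage (ι s).2
    (c0_compact f (by positivity : 0 < ε / 2 / 2)) hf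
  filter_upwards [Metric.tendstoUniformlyOn_iff.1 (hη _ hK) (ε / 2 / (‖f‖ + 1)) (by positivity)]
    with i hi
  refine ((hι.norm_approx_sub_le_iff (ξ i) s a (by positivity : 0 ≤ ε / 2)).2
    fun k hk => ?_).trans_lt (half_lt_self hε)
  refine norm_mul_le_of_le_norm (by positivity) (c0_norm_le f _) ?_ fun hfk => ?_
  · have hcoeff := (fibrewiseFinite_sectionFun ι (ξ i)).norm_coeff_le k
    have := norm_sub_le (coeff (sectionFun ι α (ξ i)) k) 1
    rw [norm_one] at this
    linarith [hsq i (range k), hsq i (source k)]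
  · rw [← dist_eq_norm, dist_comm]
    exact (hi k ⟨hk, hfk⟩).le

theorem IsWideHom.exists_section_norm_coeff_sub_one_le (hι : IsWideHom ι α)
    (hα : α.HasApproximationProperty) {K : Set G} (hK : IsCompact K) {ε : ℝ} (hε : 0 < ε) :
    ∃ ξ ∈ α.fellBundle.sections, ∀ g ∈ K, ‖coeff (sectionFun ι α ξ) g - 1‖ ≤ ε := by
  obtain ⟨I, _, _, _, ξ, hξ, -, htendsto⟩ := hα
  suffices H : ∀ᶠ i in atTop, ∀ g ∈ K, ‖coeff (sectionFun ι α (ξ i)) g - 1‖ ≤ ε by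
    obtain ⟨i, hi⟩ := H.exists
    exact ⟨ξ i, hξ i, hi⟩
  refine hK.induction_on (p := fun K => ∀ᶠ i in atTop, ∀ g ∈ K,
    ‖coeff (sectionFun ι α (ξ i)) g - 1‖ ≤ ε) ?_ ?_ ?_ ?_
  · exact Eventually.of_forall fun _ g hg => hg.elim
  · intro K L hKL hL
    filter_upwards [hL] with i hi g hg using hi g (hKL hg)
  · intro K L hK hL
    filter_upwards [hK, hL] with i hiK hiL g hg using hg.elim (hiK g) (hiL g)
  · intro g _
    obtain ⟨s, hs⟩ := hι.cover g
    obtain ⟨L, hgL, hLs, hL⟩ := local_compact_nhds ((ι s).2.isOpen.mem_nhds hs)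
    obtain ⟨f, hfs, hfL, -⟩ := bumpSet_nonempty (hL.image continuous_range)
      (isOpenMap_range _ (ι s).2.isOpen) (Set.image_mono hLs)
    rw [← hι.target_eq] at hfs
    refine ⟨L, mem_nhdsWithin_of_mem_nhds hgL, ?_⟩
    filter_upwards [tendsto_bidual_iff.1 (htendsto s (α.ofC0 f hfs)) ε hε] with i hi k hk
    have hcoeff := (hι.norm_approx_sub_le_iff (ξ i) s (α.ofC0 f hfs) hε.le).1 hi.le k (hLs hk)
    rwa [show α.toC0 s (α.ofC0 f hfs) = f from rfl, hfL _ ⟨k, hk, rfl⟩, mul_one] at hcoeff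

theorem IsWideHom.exists_compactlySupported_norm_coeff_sub_one_le (hι : IsWideHom ι α)
    (hα : α.HasApproximationProperty) {K : Set G} (hK : IsCompact K) {ε : ℝ} (hε : 0 < ε) :
    ∃ η ∈ CompactlySupported G, (∀ x, sqNorm η x ≤ 1) ∧ ∀ g ∈ K, ‖coeff η g - 1‖ ≤ ε := by
  obtain ⟨φ, hφK, hφc, -, hφ⟩ := exists_continuousMap_one_of_isCompact_subset_isOpen
    ((hK.image continuous_range).union (hK.image continuous_source)) isOpen_univ
    (Set.subset_univ _)
  have hφc' : IsCompact (Subtype.val '' tsupport φ : Set G) := hφc.image continuous_subtype_val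
  obtain ⟨ξ, hξ, hξle⟩ := hι.exists_section_norm_coeff_sub_one_le hα (hK.union hφc')
    (by linarith : 0 < ε / 4)
  obtain ⟨τ, hτ, hτle⟩ := hι.exists_norm_coeff_truncate_sub_le ξ (by linarith : 0 < ε / 4)
  have hcoeff : ∀ g ∈ K ∪ Subtype.val '' tsupport φ,
      ‖coeff (sectionFun ι α (α.truncate hτ ξ)) g - 1‖ ≤ ε / 2 := fun g hg => by
    linarith [norm_sub_le_norm_sub_add_norm_sub (coeff (sectionFun ι α (α.truncate hτ ξ)) g)
      (coeff (sectionFun ι α ξ) g) 1, hτle g, hξle g hg]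
  obtain ⟨η, hη, hηle, hηK⟩ := exists_normalized_cutoff
    (hι.sectionFun_truncate_mem_compactlySupported hξ hτ) (fibrewiseFinite_sectionFun ι _) hφ
    (fun g hg => ⟨hφK (Or.inl ⟨g, hg, rfl⟩), hφK (Or.inr ⟨g, hg, rfl⟩)⟩)
    (by positivity : 0 ≤ ε / 2) (fun g hg => hcoeff g (Or.inl hg))
    fun x hx => hcoeff x.1 (Or.inr ⟨x, subset_tsupport φ hx, rfl⟩)
  exact ⟨η, hη, hηle, fun g hg => (hηK g hg).trans_eq (by ring)⟩

theorem IsWideHom.amenable_iff_hasApproximationProperty (hι : IsWideHom ι α) :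
    IsTopologicallyAmenable G ↔ α.HasApproximationProperty :=
  ⟨hι.hasApproximationProperty_of_amenable, fun hα =>
    isTopologicallyAmenable_of_forall_isCompact fun _ hK _ hε =>
      hι.exists_compactlySupported_norm_coeff_sub_one_le hα hK hε⟩

end Equivalence

section Canonical

variable {G : Type u} [TopologicalSpace G] [TopGroupoid G] [IsEtale G]

theorem isWideHom_id : IsWideHom (fun u : Bis G => u) (canonicalAction G) where
  map_one := rfl
  map_mul _ _ := rfl
  map_inv _ := rfl
  act_eq _ := rfl
  cover g := by
    obtain ⟨u, hu, hg, -⟩ := exists_bisection g isOpen_univ (Set.mem_univ g)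
    exact ⟨⟨u, hu⟩, hg⟩
  unit_inter u x hx := ⟨⟨u.1 ∩ (1 : Bis G).1, isOpenBisection_inter u.2 (1 : Bis G).2.isOpen⟩,
    natLE_of_subset Set.inter_subset_left, natLE_of_subset Set.inter_subset_right, hx, x.2⟩

theorem isWideHom_canonicalActionOf {S : InverseSubsemigroup (Bis G)} (hS : IsWide S) :
    IsWideHom (fun u : S.unitize.Elem => u.1) (canonicalActionOf S) where
  map_one := rfl
  map_mul _ _ := rfl
  map_inv _ := rfl
  act_eq _ := rfl
  cover g := by
    obtain ⟨u, hu, hg⟩ := hS.1 g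
    exact ⟨⟨u, Or.inr hu⟩, hg⟩
  unit_inter := by
    rintro ⟨s, rfl | hs⟩ x hx
    · exact ⟨1, natLE_of_eq rfl, natLE_of_eq rfl, x.2⟩
    obtain ⟨w, hw, hxw⟩ := hS.1 x.1
    have hxww : x.1 ∈ (w * w⁻¹).1 := unit_mem_mul_inv_iff.2 ⟨x.1, range_unit x, hxw, hxw⟩
    obtain ⟨v, hv, hxv, hvs⟩ := hS.2 x.1 s hs _ (S.mul_mem' hw (S.inv_mem w hw)) ⟨hx, hxww⟩
    have hv1 : v.1 ⊆ (1 : Bis G).1 := fun g hg => src_eq_of_mem_idem (idem_mul_inv w) (hvs hg).2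
    let v' : S.unitize.Elem := ⟨v, Or.inr hv⟩
    exact ⟨v', ⟨v'⁻¹ * v', idem_inv_mul v', Subtype.ext (eq_mul_of_subset fun g hg => (hvs hg).1)⟩,
      idem_natLE_one (Subtype.ext (idem_of_subset_one hv1)), hxv⟩

/-- The inverse semigroup of all open bisections. -/
def allBisections : InverseSubsemigroup (Bis G) where
  carrier := Set.univ
  mul_mem' _ _ := trivial
  inv_mem _ _ := trivial

theorem isWide_allBisections : IsWide (allBisections (G := G)) := by
  refine ⟨fun g => ?_, fun g u _ v _ hg => ?_⟩
  · obtain ⟨u, hu⟩ := isWideHom_id.cover g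
    exact ⟨u, trivial, hu⟩
  · exact ⟨⟨u.1 ∩ v.1, isOpenBisection_inter u.2 v.2.isOpen⟩, trivial, hg, subset_rfl⟩

end Canonical

end TopGroupoid

end InvFell

end

theorem corollary4p19 {G : Type*} [TopologicalSpace G] [InvFell.TopGroupoid G]
    [LocallyCompactSpace G] [InvFell.TopGroupoid.IsEtale G]
    [T2Space (InvFell.TopGroupoid.UnitSpace G)] :
    [InvFell.TopGroupoid.IsTopologicallyAmenable G,
      (InvFell.TopGroupoid.canonicalAction G).HasApproximationProperty,
      ∀ S : InvFell.InverseSubsemigroup (InvFell.TopGroupoid.Bis G),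
        InvFell.TopGroupoid.IsWide S →
          (InvFell.TopGroupoid.canonicalActionOf S).HasApproximationProperty].TFAE ∧
    ∀ S : InvFell.InverseSubsemigroup (InvFell.TopGroupoid.Bis G),
      InvFell.TopGroupoid.IsWide S →
        (InvFell.TopGroupoid.IsTopologicallyAmenable G ↔
          (InvFell.TopGroupoid.canonicalActionOf S).HasApproximationProperty) := by
  have key : ∀ S : InvFell.InverseSubsemigroup (InvFell.TopGroupoid.Bis G),
      InvFell.TopGroupoid.IsWide S →
        (InvFell.TopGroupoid.IsTopologicallyAmenable G ↔
          (InvFell.TopGroupoid.canonicalActionOf S).HasApproximationProperty) := fun S hS =>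
    (InvFell.TopGroupoid.isWideHom_canonicalActionOf hS).amenable_iff_hasApproximationProperty
  refine ⟨?_, key⟩
  tfae_have 1 ↔ 2 := InvFell.TopGroupoid.isWideHom_id.amenable_iff_hasApproximationProperty
  tfae_have 1 → 3 := fun h S hS => (key S hS).1 h
  tfae_have 3 → 1 := fun h => (key _ InvFell.TopGroupoid.isWide_allBisections).2
    (h _ InvFell.TopGroupoid.isWide_allBisections)
  tfae_finish
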